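/- A $0$-$1$ matrix $A$ *contains* a $0$-$1$ matrix $P$ if some submatrix of $A$ either equals $P$ or can be turned into $P$ by changing some ones to zeroes; otherwise $A$ *avoids* $P$. Let $\mathrm{ex}(n,P)$ be the maximum number of ones in an $n\times n$ $0$-$1$ matrix that avoids $P$ (read as $0$ if there is no such matrix). A $0$-$1$ matrix $P$ is *minimally non-linear* if $\mathrm{ex}(n,P)=\omega(n)$, but $\mathrm{ex}(n,P')=O(n)$ for every $P'$ that is contained in $P$ and not equal to $P$. In the displays $\bullet$ is a one and a blank is a zero. Put $$Q_3=\begin{pmatrix}\bullet&&\bullet\\&\bullet&\\&&\bullet\end{pmatrix},\qquad S_2=\begin{pmatrix}\bullet&&&\\&&\bullet&\\&\bullet&&\bullet\end{pmatrix}.$$ **Theorem.** Let $M$ be a minimally non-linear $0$-$1$ matrix which is not $Q_3$ or $S_2$ or obtained from one of these by a left-right reflection, a top-bottom reflection, or both. Then the relative positions of the ones in the top and bottom rows of $M$ are given by one of the following sixteen two-row matrices, or by its left-right reflection, its top-bottom reflection, or its rotation by $180^\circ$: $$\begin{pmatrix}\bullet&\bullet\\\bullet&\bullet\end{pmatrix}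 \begin{pmatrix}\bullet&&\bullet\\\bullet&\bullet&\end{pmatrix} \begin{pmatrix}\bullet&&\bullet&\\&\bullet&&\bullet\end{pmatrix}$$ $$\begin{pmatrix}&&\bullet&&\\\bullet&\bullet&&\bullet&\bullet\end{pmatrix} \begin{pmatrix}&&\bullet&\bullet&&\\\bullet&\bullet&&&\bullet&\bullet\end{pmatrix}$$ $$\begin{pmatrix}&\bullet&\\\bullet&\bullet&\bullet\end{pmatrix} \begin{pmatrix}&&\bullet&\\\bullet&\bullet&&\bullet\end{pmatrix} \begin{pmatrix}&&\bullet&\bullet&\\\bullet&\bullet&&&\bullet\end{pmatrix}$$ $$\begin{pmatrix}&\bullet&\bullet&\\\bullet&&&\bullet\end{pmatrix} \begin{pmatrix}&\bullet&\\\bullet&&\bullet\end{pmatrix} \begin{pmatrix}&\bullet\\\bullet&\bullet\end{pmatrix} \begin{pmatrix}&\bullet&\bullet\\\bullet&\bullet&\end{pmatrix} \begin{pmatrix}&&\bullet&\bullet\\\bullet&\bullet&&\end{pmatrix} \begin{pmatrix}&&\bullet\\\bullet&\bullet&\end{pmatrix}$$ $$\begin{pmatrix}&\bullet\\\bullet&\end{pmatrix}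 \begin{pmatrix}\bullet\\\bullet\end{pmatrix}$$ Here the relative positions are given by a two-row matrix $F$ if the columns of $F$ can be placed, in increasing order, at columns of $M$ so that the ones of the top row of $M$ are exactly the ones of the top row of $F$, the ones of the bottom row of $M$ are exactly the ones of the bottom row of $F$, and no extra columns are inserted between adjacent ones of the same row: if $F$ has ones in columns $j$ and $j+1$ of the same row, these columns are placed at consecutive columns of $M$. Elsewhere, columns of $M$ with no one in the top and bottom rows may be inserted. -/

import Mathlib

open scoped Asymptotics

/-- `h × w` matrices with entries in `{0, 1}`; row `0` is the top row, column `0` the leftmost. -/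
abbrev ZeroOneMatrix (h w : ℕ) : Type := Matrix (Fin h) (Fin w) (Fin 2)

/-- A 0-1 matrix together with its dimensions, to compare matrices of different sizes. -/
abbrev SizedZeroOneMatrix : Type := Σ h w : ℕ, ZeroOneMatrix h w

namespace ZeroOneMatrix

/-- `A` contains `P`: some submatrix of `A` equals `P` or can be turned into `P` by changing some
ones to zeroes. -/
def Contains {m n h w : ℕ} (A : ZeroOneMatrix m n) (P : ZeroOneMatrix h w) : Prop :=
  ∃ (r : Fin h ↪o Fin m) (c : Fin w ↪o Fin n), ∀ i j, P i j = 1 → A (r i) (c j) = 1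

/-- The number of ones of a 0-1 matrix. -/
def ones {m n : ℕ} (A : ZeroOneMatrix m n) : ℕ :=
  (Finset.univ.filter fun p : Fin m × Fin n => A p.1 p.2 = 1).card

open Classical in
/-- `ex n P`: the maximum number of ones in an `n × n` 0-1 matrix that avoids `P`
(and `0` if there is no such matrix, which happens only if `P` has no ones). -/
noncomputable def ex (n : ℕ) {h w : ℕ} (P : ZeroOneMatrix h w) : ℕ :=
  (Finset.univ.filter fun A : ZeroOneMatrix n n => ¬ A.Contains P).sup ones

/-- `P` is minimally non-linear: `ex(n, P) = ω(n)`, but `ex(n, P') = O(n)` for every `P'` that is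
contained in `P` and not equal to `P`. -/
def MinimallyNonlinear {h w : ℕ} (P : ZeroOneMatrix h w) : Prop :=
  (fun n : ℕ => (n : ℝ)) =o[Filter.atTop] (fun n : ℕ => (ex n P : ℝ)) ∧
  ∀ (h' w' : ℕ) (P' : ZeroOneMatrix h' w'), P.Contains P' →
    (⟨h', w', P'⟩ : SizedZeroOneMatrix) ≠ ⟨h, w, P⟩ →
    (fun n : ℕ => (ex n P' : ℝ)) =O[Filter.atTop] (fun n : ℕ => (n : ℝ))

/-- The matrix itself, its left-right reflection, its top-bottom reflection, and its rotation by a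
half-turn. -/
def reflections {h w : ℕ} (A : ZeroOneMatrix h w) : List (ZeroOneMatrix h w) :=
  [A, A.submatrix id Fin.rev, A.submatrix Fin.rev id, A.submatrix Fin.rev Fin.rev]

/-- The set of columns in which the top row of `M` has a one. -/
def topOnes {h w : ℕ} (M : ZeroOneMatrix h w) : Set (Fin w) :=
  {j | ∃ i : Fin h, (i : ℕ) = 0 ∧ M i j = 1}

/-- The set of columns in which the bottom row of `M` has a one. -/
def bottomOnes {h w : ℕ} (M : ZeroOneMatrix h w) : Set (Fin w) :=
  {j | ∃ i : Fin h, (i : ℕ) + 1 = h ∧ M i j = 1}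

/-- The relative positions of the ones in the top and bottom rows of `M` are those of the two-row
matrix `F`: the columns of `F` can be placed in increasing order at columns of `M` so that the ones
of the top (bottom) row of `M` are exactly the ones of the top (bottom) row of `F`, where two ones
in the same row and in adjacent columns of `F` are placed at adjacent columns of `M`. -/
def HasTopBottom {h w v : ℕ} (M : ZeroOneMatrix h w) (F : ZeroOneMatrix 2 v) : Prop :=
  ∃ c : Fin v ↪o Fin w,
    M.topOnes = c '' {j | F 0 j = 1} ∧
    M.bottomOnes = c '' {j | F 1 j = 1} ∧
    ∀ (i : Fin 2) (j k : Fin v), (k : ℕ) = (j : ℕ) + 1 → F i j = 1 → F i k = 1 →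
      (c k : ℕ) = (c j : ℕ) + 1

/-- The list of the sixteen configurations of the top and bottom rows. -/
def topBottomConfigurations : List (Σ v : ℕ, ZeroOneMatrix 2 v) :=
  [ ⟨2, !![1, 1;
           1, 1]⟩,
    ⟨3, !![1, 0, 1;
           1, 1, 0]⟩,
    ⟨4, !![1, 0, 1, 0;
           0, 1, 0, 1]⟩,
    ⟨5, !![0, 0, 1, 0, 0;
           1, 1, 0, 1, 1]⟩,
    ⟨6, !![0, 0, 1, 1, 0, 0;
           1, 1, 0, 0, 1, 1]⟩,
    ⟨3, !![0, 1, 0;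
           1, 1, 1]⟩,
    ⟨4, !![0, 0, 1, 0;
           1, 1, 0, 1]⟩,
    ⟨5, !![0, 0, 1, 1, 0;
           1, 1, 0, 0, 1]⟩,
    ⟨4, !![0, 1, 1, 0;
           1, 0, 0, 1]⟩,
    ⟨3, !![0, 1, 0;
           1, 0, 1]⟩,
    ⟨2, !![0, 1;
           1, 1]⟩,
    ⟨3, !![0, 1, 1;
           1, 1, 0]⟩,
    ⟨4, !![0, 0, 1, 1;
           1, 1, 0, 0]⟩,
    ⟨3, !![0, 0, 1;
           1, 1, 0]⟩,
    ⟨2, !![0, 1;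
           1, 0]⟩,
    ⟨1, !![1;
           1]⟩ ]

/-- The pattern `Q₃`. -/
def patternQ3 : ZeroOneMatrix 3 3 :=
  !![1, 0, 1;
     0, 1, 0;
     0, 0, 1]

/-- The pattern `S₂`. -/
def patternS2 : ZeroOneMatrix 3 4 :=
  !![1, 0, 0, 0;
     0, 0, 1, 0;
     0, 1, 0, 1]

end ZeroOneMatrix

/-! Let `T` and `B` be the sets of columns holding ones of the top and bottom rows. By minimality, a
superlinear pattern contained in `M` must be `M` itself (`MinimallyNonlinear.eq_of_contains`), so
everything rests on a supply of superlinear patterns and on one linear upper bound.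

The first three configurations are superlinear. If `M` contains a reflection of one of them, it
equals that reflection and is its own configuration. Otherwise `T` and `B` do not alternate four
times, and beside a shared column they cannot both continue on the same side.

The other constraint is the gap property: two non-adjacent ones of the top row have a one of the
bottom row strictly between their columns, and conversely. If all ones in the columns strictly
between two ones of a row lie in that row, deleting these `k` columns changes `ex` by a factor of at
most `k + 1`, because rows can be thinned (`contains_of_thin_contains`). That contradicts
minimality, so `exists_one_between` gives a one in another row. If this row is a middle one, then
together with any one of the last row it yields a reflection of `Q₃` or `S₂`. Both are superlinear,
so `M` would be an excluded matrix (`exists_bottom_between`).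

These constraints on `T` and `B` leave only the remaining thirteen configurations
(`isConfiguration_of_sets`).

The lower bounds come from three dense families: `y - x` a power of two, for the square and the
second configuration; a recursive doubling, for `Q₃`; and a composition of Davenport–Schinzel type,
for the alternation and `S₂`. -/

namespace ZeroOneMatrix

/-! ### Growth of `ex` and minimality -/

/-- `ex n P` grows faster than every linear function. -/
def Superlinear {h w : ℕ} (P : ZeroOneMatrix h w) : Prop :=
  (fun n : ℕ => (n : ℝ)) =o[Filter.atTop] (fun n : ℕ => (ex n P : ℝ))

/-- `ex n P` grows at most linearly. -/
def LinearlyBounded {h w : ℕ} (P : ZeroOneMatrix h w) : Prop :=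
  (fun n : ℕ => (ex n P : ℝ)) =O[Filter.atTop] (fun n : ℕ => (n : ℝ))

theorem ones_le_ex {n h w : ℕ} {P : ZeroOneMatrix h w} {A : ZeroOneMatrix n n}
    (hA : ¬ A.Contains P) : ones A ≤ ex n P := by
  classical
  unfold ex
  exact Finset.le_sup (f := ones) (by simpa using hA)

theorem ex_le {n h w : ℕ} {P : ZeroOneMatrix h w} {k : ℕ}
    (H : ∀ A : ZeroOneMatrix n n, ¬ A.Contains P → ones A ≤ k) : ex n P ≤ k := by
  classical
  unfold ex
  exact Finset.sup_le fun A hA => H A (by simpa using hA)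

theorem Superlinear.not_linearlyBounded {h w : ℕ} {P : ZeroOneMatrix h w} (hP : P.Superlinear) :
    ¬ P.LinearlyBounded := by
  intro hl
  have h1 : (fun n : ℕ => (n : ℝ)) =o[Filter.atTop] (fun n : ℕ => (n : ℝ)) := hP.trans_isBigO hl
  have h2 := Asymptotics.isLittleO_irrefl' (l := Filter.atTop) (f' := fun n : ℕ => (n : ℝ)) ?_
  · exact h2 h1
  · refine Filter.Eventually.frequently ?_
    filter_upwards [Filter.eventually_gt_atTop 0] with n hn
    simp; omega

theorem linearlyBounded_of_le {h w : ℕ} {P : ZeroOneMatrix h w} (k : ℕ)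
    (H : ∀ n, ex n P ≤ k * n) : P.LinearlyBounded := by
  refine Asymptotics.IsBigO.of_bound k (Filter.Eventually.of_forall fun n => ?_)
  have := H n
  simp only [Real.norm_natCast]
  exact_mod_cast this

/-- This is how every forbidden pattern is excluded: a properly contained pattern has linear `ex`,
which superlinearity rules out. -/
theorem MinimallyNonlinear.eq_of_contains {h w h' w' : ℕ} {M : ZeroOneMatrix h w}
    {P : ZeroOneMatrix h' w'} (hM : M.MinimallyNonlinear) (hP : P.Superlinear)
    (hc : M.Contains P) : (⟨h, w, M⟩ : SizedZeroOneMatrix) = ⟨h', w', P⟩ := by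
  by_contra hne
  exact hP.not_linearlyBounded (hM.2 h' w' P hc (Ne.symm hne))

/-! ### Reflections -/

theorem Contains.reflect_columns {m n h w : ℕ} {A : ZeroOneMatrix m n} {P : ZeroOneMatrix h w}
    (H : A.Contains P) : Contains (A.submatrix id Fin.rev) (P.submatrix id Fin.rev) := by
  obtain ⟨r, c, hrc⟩ := H
  refine ⟨r, OrderEmbedding.ofStrictMono (fun j => (c j.rev).rev) ?_, ?_⟩
  · intro i j hij
    simpa using hij
  · intro i j hij
    simpa [OrderEmbedding.ofStrictMono] using hrc _ _ hij

theorem Contains.reflect_rows {m n h w : ℕ} {A : ZeroOneMatrix m n} {P : ZeroOneMatrix h w}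
    (H : A.Contains P) : Contains (A.submatrix Fin.rev id) (P.submatrix Fin.rev id) := by
  obtain ⟨r, c, hrc⟩ := H
  refine ⟨OrderEmbedding.ofStrictMono (fun j => (r j.rev).rev) ?_, c, ?_⟩
  · intro i j hij
    simpa using hij
  · intro i j hij
    simpa [OrderEmbedding.ofStrictMono] using hrc _ _ hij

theorem reflect_columns_twice {h w : ℕ} (P : ZeroOneMatrix h w) :
    (P.submatrix id Fin.rev).submatrix id Fin.rev = P := by
  ext i j; simp

theorem reflect_rows_twice {h w : ℕ} (P : ZeroOneMatrix h w) :
    (P.submatrix Fin.rev id).submatrix Fin.rev id = P := by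
  ext i j; simp

theorem ones_submatrix {n : ℕ} (A : ZeroOneMatrix n n) (e f : Equiv.Perm (Fin n)) :
    ones (A.submatrix e f) = ones A := by
  unfold ones
  refine Finset.card_equiv (e.prodCongr f) fun p => ?_
  rw [Finset.mem_filter, Finset.mem_filter]
  simp

theorem ex_le_ex_reflect_columns {n h w : ℕ} (P : ZeroOneMatrix h w) :
    ex n P ≤ ex n (P.submatrix id Fin.rev) := by
  refine ex_le fun A hA => ?_
  rw [← ones_submatrix A (Equiv.refl _) Fin.revPerm]
  refine ones_le_ex fun H => hA ?_
  have := H.reflect_columns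
  rw [reflect_columns_twice] at this
  convert this using 1
  ext i j; simp

theorem ex_le_ex_reflect_rows {n h w : ℕ} (P : ZeroOneMatrix h w) :
    ex n P ≤ ex n (P.submatrix Fin.rev id) := by
  refine ex_le fun A hA => ?_
  rw [← ones_submatrix A Fin.revPerm (Equiv.refl _)]
  refine ones_le_ex fun H => hA ?_
  have := H.reflect_rows
  rw [reflect_rows_twice] at this
  convert this using 1
  ext i j; simp

theorem ex_reflect_columns {n h w : ℕ} (P : ZeroOneMatrix h w) :
    ex n (P.submatrix id Fin.rev) = ex n P := by
  refine le_antisymm ?_ (ex_le_ex_reflect_columns P)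
  have := ex_le_ex_reflect_columns (n := n) (P.submatrix id Fin.rev)
  rwa [reflect_columns_twice] at this

theorem ex_reflect_rows {n h w : ℕ} (P : ZeroOneMatrix h w) :
    ex n (P.submatrix Fin.rev id) = ex n P := by
  refine le_antisymm ?_ (ex_le_ex_reflect_rows P)
  have := ex_le_ex_reflect_rows (n := n) (P.submatrix Fin.rev id)
  rwa [reflect_rows_twice] at this

theorem Superlinear.reflect_rows {h w : ℕ} {P : ZeroOneMatrix h w} (hP : P.Superlinear) :
    Superlinear (P.submatrix Fin.rev id) := by
  unfold Superlinear at hP ⊢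
  simpa only [ex_reflect_rows] using hP

theorem Superlinear.reflect_columns {h w : ℕ} {P : ZeroOneMatrix h w} (hP : P.Superlinear) :
    Superlinear (P.submatrix id Fin.rev) := by
  unfold Superlinear at hP ⊢
  simpa only [ex_reflect_columns] using hP

theorem Superlinear.of_mem_reflections {h w : ℕ} {P A : ZeroOneMatrix h w} (hP : P.Superlinear)
    (hA : A ∈ P.reflections) : A.Superlinear := by
  simp only [reflections, List.mem_cons, List.not_mem_nil, or_false] at hA
  rcases hA with rfl | rfl | rfl | rfl
  · exact hP
  · exact hP.reflect_columns
  · exact hP.reflect_rows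
  · exact hP.reflect_columns.reflect_rows

theorem reflect_rows_mem_reflections {h w : ℕ} {P A : ZeroOneMatrix h w}
    (hA : A ∈ P.reflections) : A.submatrix Fin.rev id ∈ P.reflections := by
  simp only [reflections, List.mem_cons, List.not_mem_nil, or_false] at hA ⊢
  rcases hA with rfl | rfl | rfl | rfl
  · simp
  · right; right; right; ext i j; simp
  · left; ext i j; simp
  · right; left; ext i j; simp

/-! ### Lower bounds for `ex` from relations between finite linear orders -/

/-- The relation is padded with zeros to an `n × n` matrix. Since `P` has a one in every row and
column, a copy of `P` cannot use padding lines, so it lives in the relation itself. -/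
theorem card_le_ex_of_relation {h w n : ℕ} {P : ZeroOneMatrix h w}
    (hrow : ∀ i, ∃ j, P i j = 1) (hcol : ∀ j, ∃ i, P i j = 1)
    {X Y : Type} [LinearOrder X] [Fintype X] [LinearOrder Y] [Fintype Y] (ρ : X → Y → Prop)
    (hX : Fintype.card X ≤ n) (hY : Fintype.card Y ≤ n)
    (hρ : ¬ ∃ (r : Fin h → X) (c : Fin w → Y), StrictMono r ∧ StrictMono c ∧
      ∀ i j, P i j = 1 → ρ (r i) (c j)) :
    Nat.card {p : X × Y // ρ p.1 p.2} ≤ ex n P := by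
  classical
  let e : Fin (Fintype.card X) ≃o X := Fintype.orderIsoFinOfCardEq X rfl
  let f : Fin (Fintype.card Y) ≃o Y := Fintype.orderIsoFinOfCardEq Y rfl
  let A : ZeroOneMatrix n n := fun i j =>
    if ∃ x y, ρ x y ∧ ((e.symm x : Fin _) : ℕ) = i ∧ ((f.symm y : Fin _) : ℕ) = j then 1 else 0
  have hA : ∀ i j, A i j = 1 ↔
      ∃ x y, ρ x y ∧ ((e.symm x : Fin _) : ℕ) = i ∧ ((f.symm y : Fin _) : ℕ) = j := by
    intro i j
    simp only [A]
    split_ifs with H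
    · simpa using H
    · simpa using H
  have hav : ¬ A.Contains P := by
    rintro ⟨r, c, hrc⟩
    apply hρ
    have h1 : ∀ i, ∃ x, ((e.symm x : Fin _) : ℕ) = r i := fun i => by
      obtain ⟨j, hj⟩ := hrow i
      obtain ⟨x, y, -, hx, -⟩ := (hA _ _).1 (hrc i j hj)
      exact ⟨x, hx⟩
    have h2 : ∀ j, ∃ y, ((f.symm y : Fin _) : ℕ) = c j := fun j => by
      obtain ⟨i, hi⟩ := hcol j
      obtain ⟨x, y, -, -, hy⟩ := (hA _ _).1 (hrc i j hi)
      exact ⟨y, hy⟩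
    choose r' hr' using h1
    choose c' hc' using h2
    refine ⟨r', c', ?_, ?_, ?_⟩
    · intro a b hab
      rw [← e.symm.lt_iff_lt, Fin.lt_def, hr', hr']
      exact r.strictMono hab
    · intro a b hab
      rw [← f.symm.lt_iff_lt, Fin.lt_def, hc', hc']
      exact c.strictMono hab
    · intro i j hij
      obtain ⟨x, y, hxy, hx, hy⟩ := (hA _ _).1 (hrc i j hij)
      have hx' : x = r' i := by
        apply e.symm.injective; apply Fin.ext; rw [hx, hr']
      have hy' : y = c' j := by
        apply f.symm.injective; apply Fin.ext; rw [hy, hc']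
      rwa [← hx', ← hy']
  refine le_trans ?_ (ones_le_ex hav)
  rw [Nat.card_eq_fintype_card, Fintype.card_subtype, ones]
  refine Finset.card_le_card_of_injOn
    (fun p => ((⟨e.symm p.1, (e.symm p.1).2.trans_le hX⟩ : Fin n),
      (⟨f.symm p.2, (f.symm p.2).2.trans_le hY⟩ : Fin n))) ?_ ?_
  · intro p hp
    simp only [Finset.coe_filter, Finset.mem_univ, true_and, Set.mem_ofPred_eq] at hp ⊢
    exact (hA _ _).2 ⟨p.1, p.2, hp, rfl, rfl⟩
  · intro p _ q _ hpq
    simp only [Prod.mk.injEq, Fin.mk.injEq] at hpq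
    refine Prod.ext ?_ ?_
    · exact e.symm.injective (Fin.ext hpq.1)
    · exact f.symm.injective (Fin.ext hpq.2)

/-- Block-diagonal repetition of dense relations that avoid `P` shows that `P` is superlinear. -/
theorem superlinear_of_dense {h w : ℕ} {P : ZeroOneMatrix h w}
    (hrow : ∀ i, ∃ j, P i j = 1) (hcol : ∀ j, ∃ i, P i j = 1)
    (hconn : ∀ (f : Fin h → ℕ) (g : Fin w → ℕ), Monotone f → Monotone g →
      (∀ i j, P i j = 1 → f i = g j) → ∃ k, (∀ i, f i = k) ∧ ∀ j, g j = k)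
    (hdense : ∀ K : ℕ, ∃ (X Y : Type) (_ : LinearOrder X) (_ : Fintype X) (_ : LinearOrder Y)
      (_ : Fintype Y) (ρ : X → Y → Prop), 0 < Fintype.card X ∧
      (¬ ∃ (r : Fin h → X) (c : Fin w → Y), StrictMono r ∧ StrictMono c ∧
        ∀ i j, P i j = 1 → ρ (r i) (c j)) ∧
      K * (Fintype.card X + Fintype.card Y) ≤ Nat.card {p : X × Y // ρ p.1 p.2}) :
    P.Superlinear := by
  refine Asymptotics.isLittleO_iff.2 fun ε hε => ?_
  obtain ⟨K, hK⟩ := exists_nat_ge (2 / ε)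
  obtain ⟨X, Y, _, _, _, _, ρ, hX, hav, hcard⟩ := hdense K
  set s := Fintype.card X + Fintype.card Y with hs
  filter_upwards [Filter.eventually_ge_atTop s] with n hn
  have hs0 : 0 < s := by omega
  -- With `q` diagonal blocks, `n < 2 * q * s` while there are at least `q * K * s` ones; the choice
  -- `K ≥ 2 / ε` then gives `n ≤ ε * ex n P`.
  set q := n / s with hq
  have hq1 : 1 ≤ q := (Nat.one_le_div_iff hs0).2 hn
  have hqs : q * s ≤ n := Nat.div_mul_le_self n s
  have hn2 : n < (q + 1) * s := by
    rw [mul_comm]; exact Nat.lt_mul_div_succ n hs0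
  let ρ' : Fin q ×ₗ X → Fin q ×ₗ Y → Prop := fun x y =>
    (ofLex x).1 = (ofLex y).1 ∧ ρ (ofLex x).2 (ofLex y).2
  have hle : Nat.card {p : (Fin q ×ₗ X) × (Fin q ×ₗ Y) // ρ' p.1 p.2} ≤ ex n P := by
    refine card_le_ex_of_relation hrow hcol ρ' ?_ ?_ ?_
    · rw [Fintype.card_lex, Fintype.card_prod, Fintype.card_fin]; nlinarith
    · rw [Fintype.card_lex, Fintype.card_prod, Fintype.card_fin]; nlinarith
    · rintro ⟨r, c, hr, hc, hrc⟩
      -- The block indices of rows and columns are monotone and agree at every one of `P`, so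
      -- `hconn` puts the whole copy into a single block.
      obtain ⟨k, hk1, hk2⟩ := hconn (fun i => (ofLex (r i)).1) (fun j => (ofLex (c j)).1)
        (fun a b hab => Prod.Lex.monotone_fst _ _ (hr.monotone hab))
        (fun a b hab => Prod.Lex.monotone_fst _ _ (hc.monotone hab))
        (fun i j hij => by rw [(hrc i j hij).1])
      refine hav ⟨fun i => (ofLex (r i)).2, fun j => (ofLex (c j)).2, ?_, ?_,
        fun i j hij => (hrc i j hij).2⟩
      · intro a b hab
        rcases Prod.Lex.lt_iff.1 (hr hab) with h' | h'
        · have := hk1 a; have := hk1 b; rw [Fin.lt_def] at h'; omega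
        · exact h'.2
      · intro a b hab
        rcases Prod.Lex.lt_iff.1 (hc hab) with h' | h'
        · have := hk2 a; have := hk2 b; rw [Fin.lt_def] at h'; omega
        · exact h'.2
  have hge : q * Nat.card {p : X × Y // ρ p.1 p.2} ≤
      Nat.card {p : (Fin q ×ₗ X) × (Fin q ×ₗ Y) // ρ' p.1 p.2} := by
    have : q = Nat.card (Fin q) := by simp
    conv_lhs => rw [this]
    rw [← Nat.card_prod]
    refine Nat.card_le_card_of_injective
      (fun z => ⟨(toLex (z.1, z.2.1.1), toLex (z.1, z.2.1.2)), rfl, z.2.2⟩) ?_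
    rintro ⟨a, ⟨⟨x, y⟩, hxy⟩⟩ ⟨a', ⟨⟨x', y'⟩, hxy'⟩⟩ H
    simp only [Subtype.mk.injEq, Prod.mk.injEq, EmbeddingLike.apply_eq_iff_eq] at H
    obtain ⟨⟨rfl, rfl⟩, -, rfl⟩ := H
    rfl
  have hfin : q * (K * s) ≤ ex n P :=
    (Nat.mul_le_mul_left q hcard).trans (hge.trans hle)
  simp only [Real.norm_natCast]
  have e1 : (n : ℝ) ≤ 2 * (q * s) := by
    have : n ≤ 2 * (q * s) := by nlinarith
    exact_mod_cast this
  have e2 : (q : ℝ) * (K * s) ≤ ex n P := by exact_mod_cast hfin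
  have e3 : 2 ≤ ε * K := by
    rw [div_le_iff₀ hε] at hK; linarith
  have e4 : (0 : ℝ) ≤ q * s := by positivity
  calc (n : ℝ) ≤ 2 * (q * s) := e1
    _ ≤ ε * K * (q * s) := by gcongr
    _ = ε * (q * (K * s)) := by ring
    _ ≤ ε * ex n P := by gcongr

/-! ### Patterns avoided by the relation `y - x` is a power of two -/

theorem exists_dense_two_pow (K : ℕ) :
    K * 2 ^ K ≤ Nat.card {p : Fin (2 ^ K) × Fin (2 ^ (K + 1)) //
      ∃ k < K, (p.2 : ℕ) = p.1 + 2 ^ k} := by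
  have : K * 2 ^ K = Nat.card (Fin K × Fin (2 ^ K)) := by simp
  rw [this]
  refine Nat.card_le_card_of_injective
    (fun z => ⟨(z.2, ⟨z.2 + 2 ^ (z.1 : ℕ), ?_⟩), z.1, z.1.2, rfl⟩) ?_
  · have h1 := z.2.2
    have h2 : 2 ^ (z.1 : ℕ) < 2 ^ K := Nat.pow_lt_pow_right (by norm_num) z.1.2
    rw [pow_succ]; omega
  · rintro ⟨a, b⟩ ⟨a', b'⟩ H
    simp only [Subtype.mk.injEq, Prod.mk.injEq, Fin.mk.injEq] at H
    obtain ⟨rfl, H⟩ := H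
    have : 2 ^ (a : ℕ) = 2 ^ (a' : ℕ) := by omega
    rw [Fin.ext (Nat.pow_right_injective le_rfl this)]

theorem superlinear_of_two_pow {h w : ℕ} {P : ZeroOneMatrix h w}
    (hrow : ∀ i, ∃ j, P i j = 1) (hcol : ∀ j, ∃ i, P i j = 1)
    (hconn : ∀ (f : Fin h → ℕ) (g : Fin w → ℕ), Monotone f → Monotone g →
      (∀ i j, P i j = 1 → f i = g j) → ∃ k, (∀ i, f i = k) ∧ ∀ j, g j = k)
    (hav : ¬ ∃ (r : Fin h → ℕ) (c : Fin w → ℕ), StrictMono r ∧ StrictMono c ∧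
        ∀ i j, P i j = 1 → ∃ k, c j = r i + 2 ^ k) : P.Superlinear := by
  -- The exponent `3 * K` matches the total size `2 ^ (3 * K) + 2 ^ (3 * K + 1) = 3 * 2 ^ (3 * K)`.
  refine superlinear_of_dense hrow hcol hconn fun K =>
    ⟨Fin (2 ^ (3 * K)), Fin (2 ^ (3 * K + 1)), inferInstance, inferInstance, inferInstance,
      inferInstance, fun x y => ∃ k < 3 * K, (y : ℕ) = x + 2 ^ k, by simp, ?_, ?_⟩
  · rintro ⟨r, c, hr, hc, hrc⟩
    refine hav ⟨fun i => r i, fun j => c j, fun a b hab => hr hab, fun a b hab => hc hab,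
      fun i j hij => ?_⟩
    obtain ⟨k, -, hk⟩ := hrc i j hij
    exact ⟨k, hk⟩
  · have := exists_dense_two_pow (3 * K)
    simp only [Fintype.card_fin]
    refine le_trans (le_of_eq ?_) this
    ring

theorem two_mul_two_pow_le {a b : ℕ} (h : 2 ^ a < 2 ^ b) : 2 * 2 ^ a ≤ 2 ^ b := by
  have : a < b := (Nat.pow_lt_pow_iff_right (by norm_num)).1 h
  calc 2 * 2 ^ a = 2 ^ (a + 1) := by ring
    _ ≤ 2 ^ b := Nat.pow_le_pow_right (by norm_num) this

/-- The four differences satisfy `2 ^ k1 + 2 ^ k4 = 2 ^ k2 + 2 ^ k3`. Here `2 ^ k2` is strictly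
larger than both terms on the left, each of which is therefore at most half of it, forcing `2 ^ k3 ≤
0`. -/
theorem superlinear_square : Superlinear !![1, 1; 1, 1] := by
  refine superlinear_of_two_pow ?_ ?_ ?_ ?_
  · exact fun i => ⟨0, by fin_cases i <;> rfl⟩
  · exact fun j => ⟨0, by fin_cases j <;> rfl⟩
  · intro f g hf hg H
    have h1 := H 0 0 rfl
    have h2 := H 0 1 rfl
    have h3 := H 1 0 rfl
    refine ⟨f 0, fun i => ?_, fun j => ?_⟩
    · (fin_cases i <;> simp); omega
    · fin_cases j <;> (simp; omega)
  · rintro ⟨r, c, hr, hc, hrc⟩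
    obtain ⟨k1, h1⟩ := hrc 0 0 rfl
    obtain ⟨k2, h2⟩ := hrc 0 1 rfl
    obtain ⟨k3, h3⟩ := hrc 1 0 rfl
    obtain ⟨k4, h4⟩ := hrc 1 1 rfl
    have hr1 := hr (show (0 : Fin 2) < 1 by decide)
    have hc1 := hc (show (0 : Fin 2) < 1 by decide)
    have a1 := two_mul_two_pow_le (a := k1) (b := k2) (by omega)
    have a2 := two_mul_two_pow_le (a := k4) (b := k2) (by omega)
    have a3 : 0 < 2 ^ k3 := by positivity
    omega

/-- The argument for the square survives: moving one entry to an earlier column only turns the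
equation into `2 ^ k1 + 2 ^ k4 > 2 ^ k2 + 2 ^ k3`, which is still incompatible with the halving
bounds. -/
theorem superlinear_shared : Superlinear !![0, 1, 1; 1, 0, 1] := by
  refine superlinear_of_two_pow ?_ ?_ ?_ ?_
  · exact fun i => ⟨2, by fin_cases i <;> rfl⟩
  · intro j
    fin_cases j
    exacts [⟨1, rfl⟩, ⟨0, rfl⟩, ⟨0, rfl⟩]
  · intro f g hf hg H
    have h1 := H 0 1 rfl
    have h2 := H 0 2 rfl
    have h3 := H 1 0 rfl
    have h4 := H 1 2 rfl
    refine ⟨f 0, fun i => ?_, fun j => ?_⟩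
    · (fin_cases i <;> simp); omega
    · fin_cases j <;> (simp; omega)
  · rintro ⟨r, c, hr, hc, hrc⟩
    obtain ⟨k1, h1⟩ := hrc 0 1 rfl
    obtain ⟨k2, h2⟩ := hrc 0 2 rfl
    obtain ⟨k3, h3⟩ := hrc 1 0 rfl
    obtain ⟨k4, h4⟩ := hrc 1 2 rfl
    have hr1 := hr (show (0 : Fin 2) < 1 by decide)
    have hc1 := hc (show (0 : Fin 3) < 1 by decide)
    have hc2 := hc (show (1 : Fin 3) < 2 by decide)
    have a1 := two_mul_two_pow_le (a := k1) (b := k2) (by omega)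
    have a2 := two_mul_two_pow_le (a := k4) (b := k2) (by omega)
    have a3 : 0 < 2 ^ k3 := by positivity
    omega

/-! ### The pattern `Q₃` -/

/-- Recursive doubling: two copies are stacked in the rows and interleaved in the columns, and each
row `x` of the upper copy gets one extra one, in the lower copy's twin of its first column `φ x`.
The count `f` of ones satisfies `f (K + 1) ≥ 2 * f K + 2 ^ K`. The facts about `φ` are carried along
because extra ones are compared with first ones. -/
theorem exists_dense_avoiding_Q3 (K : ℕ) :
    ∃ (X Y : Type) (_ : LinearOrder X) (_ : Fintype X) (_ : LinearOrder Y) (_ : Fintype Y)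
      (ρ : X → Y → Prop) (φ : X → Y), Fintype.card X = 2 ^ K ∧ Fintype.card Y = 2 ^ K ∧
      K * 2 ^ K ≤ 2 * Nat.card {p : X × Y // ρ p.1 p.2} ∧
      Function.Injective φ ∧ (∀ x, ρ x (φ x)) ∧ (∀ x y, ρ x y → φ x ≤ y) ∧
      ∀ a b c u v w, a < b → b < c → u < v → v < w → ρ a u → ρ a w → ρ b v → ρ c w → False := by
  induction K with
  | zero =>
    refine ⟨Fin 1, Fin 1, inferInstance, inferInstance, inferInstance, inferInstance,
      fun _ _ => True, id, rfl, rfl, by simp, fun _ _ h => h, fun _ => trivial,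
      fun x y _ => (Subsingleton.elim x y).le, ?_⟩
    intro a b c u v w hab
    exact absurd (Subsingleton.elim a b) hab.ne
  | succ K ih =>
    obtain ⟨X, Y, _, _, _, _, ρ, φ, hX, hY, hcard, hφ, hρφ, hle, hav⟩ := ih
    refine ⟨Bool ×ₗ X, Y ×ₗ Bool, inferInstance, inferInstance, inferInstance, inferInstance,
      fun p q => ((ofLex p).1 = (ofLex q).2 ∧ ρ (ofLex p).2 (ofLex q).1) ∨
        ((ofLex p).1 = false ∧ (ofLex q).2 = true ∧ (ofLex q).1 = φ (ofLex p).2),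
      fun p => toLex (φ (ofLex p).2, (ofLex p).1), ?_, ?_, ?_, ?_, ?_, ?_, ?_⟩
    · rw [Fintype.card_lex, Fintype.card_prod, hX, pow_succ]; simp [mul_comm]
    · rw [Fintype.card_lex, Fintype.card_prod, hY, pow_succ]; simp
    · have key : Nat.card ((Bool × {p : X × Y // ρ p.1 p.2}) ⊕ X) ≤
          Nat.card {p : (Bool ×ₗ X) × (Y ×ₗ Bool) //
            ((ofLex p.1).1 = (ofLex p.2).2 ∧ ρ (ofLex p.1).2 (ofLex p.2).1) ∨
            ((ofLex p.1).1 = false ∧ (ofLex p.2).2 = true ∧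
              (ofLex p.2).1 = φ (ofLex p.1).2)} := by
        refine Nat.card_le_card_of_injective (fun z => match z with
          | Sum.inl (b, z) => ⟨(toLex (b, z.1.1), toLex (z.1.2, b)), Or.inl ⟨rfl, z.2⟩⟩
          | Sum.inr x => ⟨(toLex (false, x), toLex (φ x, true)), Or.inr ⟨rfl, rfl, rfl⟩⟩) ?_
        rintro (⟨b, ⟨⟨x, y⟩, hz⟩⟩ | x) (⟨b', ⟨⟨x', y'⟩, hz'⟩⟩ | x') H <;>
          simp only [Subtype.mk.injEq, Prod.mk.injEq, EmbeddingLike.apply_eq_iff_eq] at H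
        · obtain ⟨⟨rfl, rfl⟩, rfl, -⟩ := H
          rfl
        · obtain ⟨⟨rfl, -⟩, -, h⟩ := H
          cases h
        · obtain ⟨⟨rfl, -⟩, -, h⟩ := H
          cases h
        · rw [H.1.2]
      refine le_trans ?_ (Nat.mul_le_mul_left 2 key)
      rw [Nat.card_sum, Nat.card_prod, Nat.card_eq_fintype_card (α := X), hX, pow_succ]
      simp only [Nat.card_eq_fintype_card, Fintype.card_bool] at hcard ⊢
      nlinarith
    · rintro ⟨b, x⟩ ⟨b', x'⟩ H
      have := congrArg ofLex H
      simp only [ofLex_toLex, Prod.mk.injEq] at this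
      exact congrArg toLex (Prod.ext this.2 (hφ this.1))
    · exact fun x => Or.inl ⟨rfl, hρφ _⟩
    · rintro ⟨b, x⟩ ⟨y, b'⟩ (⟨h1, h2⟩ | ⟨h1, h2, h3⟩)
      · refine Prod.Lex.le_iff.2 ?_
        rcases (hle _ _ h2).lt_or_eq with h | h
        · exact Or.inl h
        · exact Or.inr ⟨h, h1.le⟩
      · refine Prod.Lex.le_iff.2 (Or.inr ⟨h3.symm, ?_⟩)
        simp only [ofLex_toLex, h1]
        exact Bool.false_le _
    · intro a b c u v w hab hbc huv hvw hau haw hbv hcw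
      rw [Prod.Lex.lt_iff] at hab hbc huv hvw
      generalize (ofLex a).1 = a1, (ofLex a).2 = a2, (ofLex b).1 = b1, (ofLex b).2 = b2,
        (ofLex c).1 = c1, (ofLex c).2 = c2, (ofLex u).1 = u1, (ofLex u).2 = u2,
        (ofLex v).1 = v1, (ofLex v).2 = v2, (ofLex w).1 = w1, (ofLex w).2 = w2 at *
      have huv' : u1 ≤ v1 := by
        rcases huv with h | h
        exacts [h.le, h.1.le]
      have hvw' : v1 ≤ w1 := by
        rcases hvw with h | h
        exacts [h.le, h.1.le]
      have hau' : ρ a2 u1 := by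
        rcases hau with h | h
        · exact h.2
        · rw [h.2.2]; exact hρφ _
      rcases haw with ⟨rfl, haw⟩ | ⟨rfl, rfl, rfl⟩
      -- If the last one of row `a` is not extra, then rows `a` and `c`, and hence `b` between them,
      -- lie in the same copy, and the pattern can be projected to it.
      · have hc : a1 = c1 ∧ ρ c2 w1 := by
          rcases hcw with ⟨h1, h2⟩ | ⟨rfl, rfl, -⟩
          · exact ⟨h1.symm, h2⟩
          · cases b1 <;> simp [Bool.lt_iff] at hab hbc
        obtain ⟨rfl, hcw'⟩ := hc
        have hb : a1 = b1 := by
          cases a1 <;> cases b1 <;> simp [Bool.lt_iff] at hab hbc ⊢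
        subst hb
        simp only [lt_irrefl, false_or, true_and] at hab hbc
        rcases hbv with ⟨rfl, hbv⟩ | ⟨rfl, rfl, rfl⟩
        · have hvw2 : v1 < w1 := by simpa [Bool.lt_iff] using hvw
          have huv2 : u1 < v1 := by
            rcases huv with h | ⟨rfl, h⟩
            · exact h
            · rcases hau with ⟨rfl, -⟩ | ⟨rfl, rfl, -⟩ <;> simp [Bool.lt_iff] at h
          exact hav _ _ _ _ _ _ hab hbc huv2 hvw2 hau' haw hbv hcw'
        -- An extra one in row `b` is replaced by the first one of `b`, and `u` by the first one of
        -- `a`; injectivity of `φ` keeps these two columns distinct.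
        · have hvw2 : φ b2 < w1 := by simpa [Bool.lt_iff] using hvw
          have hlt : φ a2 < φ b2 :=
            lt_of_le_of_ne ((hle _ _ hau').trans huv') fun h => hab.ne (hφ h)
          exact hav _ _ _ _ _ _ hab hbc hlt hvw2 (hρφ _) haw (hρφ _) hcw'
      -- If the last one of row `a` is extra, all three columns project to `φ a2`, but only two
      -- columns do.
      · have h1 := hle _ _ hau'
        obtain rfl : u1 = v1 := le_antisymm huv' (hvw'.trans h1)
        obtain rfl : u1 = φ a2 := le_antisymm hvw' h1
        cases u2 <;> cases v2 <;> simp [Bool.lt_iff] at huv hvw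

theorem superlinear_Q3 : Superlinear patternQ3 := by
  refine superlinear_of_dense ?_ ?_ ?_ fun K => ?_
  · intro i
    fin_cases i
    exacts [⟨0, rfl⟩, ⟨1, rfl⟩, ⟨2, rfl⟩]
  · intro j
    fin_cases j
    exacts [⟨0, rfl⟩, ⟨1, rfl⟩, ⟨0, rfl⟩]
  · intro f g hf hg H
    have h1 := H 0 0 rfl
    have h2 := H 0 2 rfl
    have h3 := H 1 1 rfl
    have h4 := H 2 2 rfl
    have hf1 := hf (show (0 : Fin 3) ≤ 1 by decide)
    have hf2 := hf (show (1 : Fin 3) ≤ 2 by decide)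
    refine ⟨f 0, fun i => ?_, fun j => ?_⟩
    · fin_cases i <;> simp <;> omega
    · fin_cases j <;> simp <;> omega
  · obtain ⟨X, Y, iX, jX, iY, jY, ρ, φ, hX, hY, hcard, -, -, -, hav⟩ :=
      exists_dense_avoiding_Q3 (4 * K)
    refine ⟨X, Y, iX, jX, iY, jY, ρ, by rw [hX]; positivity, ?_, ?_⟩
    · rintro ⟨r, c, hr, hc, hrc⟩
      exact hav _ _ _ _ _ _ (hr (show (0 : Fin 3) < 1 by decide))
        (hr (show (1 : Fin 3) < 2 by decide)) (hc (show (0 : Fin 3) < 1 by decide))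
        (hc (show (1 : Fin 3) < 2 by decide)) (hrc 0 0 rfl) (hrc 0 2 rfl) (hrc 1 1 rfl)
        (hrc 2 2 rfl)
    · rw [hX, hY]; linarith

/-! ### A superlinear relation without alternations of length four -/

/-- A relation between rows, indexed by `Λ × J` in lexicographic order, and columns `C`: the row
`(i, s)` begins in the column `live i`, the columns in the range of `live` contain only beginnings
of rows, and no later row alternates `x y x y` with an earlier one. -/
structure IsAlternationFree {Λ J C : Type} [LinearOrder Λ] [LinearOrder J] [LinearOrder C]
    (live : Λ → C) (R : Λ → J → C → Prop) : Prop where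
  strictMono : StrictMono live
  rel_live : ∀ i s, R i s (live i)
  live_le : ∀ i s c, R i s c → live i ≤ c
  eq_of_rel_live : ∀ i s j, R i s (live j) → i = j
  -- The inequality `c₁ ≤ c₂` is weak because distinct columns of a composition may have the same
  -- outer column.
  avoid : ∀ i s j t c₁ c₂ c₃ c₄, j < i ∨ (j = i ∧ t < s) → R i s c₁ → R j t c₂ → R i s c₃ →
    R j t c₄ → c₁ ≤ c₂ → c₂ < c₃ → c₃ < c₄ → False

/-! ### Composition of alternation-free relations -/

section Composition

set_option linter.unusedSectionVars false

variable {Λₒ Λᵢ J Cₒ Cᵢ : Type} [LinearOrder Λₒ] [LinearOrder Λᵢ] [LinearOrder J]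
  [LinearOrder Cₒ] [LinearOrder Cᵢ]

/-- The columns of the composition: every live column `c` of the outer relation is preceded by
a copy of the columns of the inner relation. -/
abbrev ComposedColumns (live : Λₒ → Cₒ) (Cᵢ : Type) [LinearOrder Cᵢ] : Type :=
  {p : Cₒ ×ₗ WithTop Cᵢ // (ofLex p).2 = ⊤ ∨ ∃ i, (ofLex p).1 = live i}

/-- The live columns of the composition. -/
def composedLive (liveₒ : Λₒ → Cₒ) (liveᵢ : Λᵢ → Cᵢ) (p : Λₒ ×ₗ Λᵢ) : ComposedColumns liveₒ Cᵢ :=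
  ⟨toLex (liveₒ (ofLex p).1, (liveᵢ (ofLex p).2 : WithTop Cᵢ)), Or.inr ⟨_, rfl⟩⟩

/-- The composition: in each copy of the inner relation, the outer rows that begin in the
corresponding live column begin one by one in the live columns of the copy. -/
def composedRel (liveₒ : Λₒ → Cₒ) (Rₒ : Λₒ → Λᵢ → Cₒ → Prop) (liveᵢ : Λᵢ → Cᵢ)
    (Rᵢ : Λᵢ → J → Cᵢ → Prop) (p : Λₒ ×ₗ Λᵢ) (s : WithTop J) (c : ComposedColumns liveₒ Cᵢ) :
    Prop :=
  match s with
  | ⊤ => ((ofLex c.1).2 = ⊤ ∧ Rₒ (ofLex p).1 (ofLex p).2 (ofLex c.1).1) ∨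
      ((ofLex c.1).1 = liveₒ (ofLex p).1 ∧ (ofLex c.1).2 = (liveᵢ (ofLex p).2 : WithTop Cᵢ))
  | (s : J) => (ofLex c.1).1 = liveₒ (ofLex p).1 ∧
      ∃ d : Cᵢ, (ofLex c.1).2 = (d : WithTop Cᵢ) ∧ Rᵢ (ofLex p).2 s d

variable {liveₒ : Λₒ → Cₒ} {Rₒ : Λₒ → Λᵢ → Cₒ → Prop} {liveᵢ : Λᵢ → Cᵢ} {Rᵢ : Λᵢ → J → Cᵢ → Prop}

theorem composedRel_top {p : Λₒ ×ₗ Λᵢ} {c : ComposedColumns liveₒ Cᵢ} :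
    composedRel liveₒ Rₒ liveᵢ Rᵢ p ⊤ c ↔
      ((ofLex c.1).2 = ⊤ ∧ Rₒ (ofLex p).1 (ofLex p).2 (ofLex c.1).1) ∨
      ((ofLex c.1).1 = liveₒ (ofLex p).1 ∧ (ofLex c.1).2 = (liveᵢ (ofLex p).2 : WithTop Cᵢ)) :=
  Iff.rfl

theorem composedRel_coe {p : Λₒ ×ₗ Λᵢ} {s : J} {c : ComposedColumns liveₒ Cᵢ} :
    composedRel liveₒ Rₒ liveᵢ Rᵢ p (s : WithTop J) c ↔
      (ofLex c.1).1 = liveₒ (ofLex p).1 ∧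
        ∃ d : Cᵢ, (ofLex c.1).2 = (d : WithTop Cᵢ) ∧ Rᵢ (ofLex p).2 s d :=
  Iff.rfl

theorem composedColumns_le {c c' : ComposedColumns liveₒ Cᵢ} : c ≤ c' ↔
    (ofLex c.1).1 < (ofLex c'.1).1 ∨
      (ofLex c.1).1 = (ofLex c'.1).1 ∧ (ofLex c.1).2 ≤ (ofLex c'.1).2 :=
  Prod.Lex.le_iff

theorem composedColumns_lt {c c' : ComposedColumns liveₒ Cᵢ} : c < c' ↔
    (ofLex c.1).1 < (ofLex c'.1).1 ∨
      (ofLex c.1).1 = (ofLex c'.1).1 ∧ (ofLex c.1).2 < (ofLex c'.1).2 :=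
  Prod.Lex.lt_iff

theorem composedRel_top_outer (hₒ : IsAlternationFree liveₒ Rₒ) {p : Λₒ ×ₗ Λᵢ}
    {c : ComposedColumns liveₒ Cᵢ} (H : composedRel liveₒ Rₒ liveᵢ Rᵢ p ⊤ c) :
    Rₒ (ofLex p).1 (ofLex p).2 (ofLex c.1).1 := by
  rcases H with H | H
  · exact H.2
  · rw [H.1]; exact hₒ.rel_live _ _

/-- The column `⊤` closes its block, so a one of an outer row that is followed by a column of the
same block must be the new first one of that row. -/
theorem composedRel_top_of_lt {p : Λₒ ×ₗ Λᵢ} {c c' : ComposedColumns liveₒ Cᵢ}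
    (H : composedRel liveₒ Rₒ liveᵢ Rᵢ p ⊤ c) (hlt : c < c')
    (heq : (ofLex c'.1).1 = (ofLex c.1).1) :
    (ofLex c.1).1 = liveₒ (ofLex p).1 ∧ (ofLex c.1).2 = (liveᵢ (ofLex p).2 : WithTop Cᵢ) := by
  rcases H with H | H
  · exfalso
    rcases composedColumns_lt.1 hlt with h | h
    · exact h.ne heq.symm
    · rw [H.1] at h; exact not_top_lt h.2
  · exact H

theorem composedLive_le (hₒ : IsAlternationFree liveₒ Rₒ) (hᵢ : IsAlternationFree liveᵢ Rᵢ)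
    {p : Λₒ ×ₗ Λᵢ} {s : WithTop J} {c : ComposedColumns liveₒ Cᵢ}
    (H : composedRel liveₒ Rₒ liveᵢ Rᵢ p s c) : composedLive liveₒ liveᵢ p ≤ c := by
  rw [composedColumns_le]
  simp only [composedLive, ofLex_toLex]
  cases s with
  | top =>
    rcases composedRel_top.1 H with H | H
    · rcases (hₒ.live_le _ _ _ H.2).lt_or_eq with h | h
      · exact Or.inl h
      · exact Or.inr ⟨h, by rw [H.1]; exact le_top⟩
    · exact Or.inr ⟨H.1.symm, H.2.ge⟩
  | coe s =>
    obtain ⟨h1, d, h2, h3⟩ := composedRel_coe.1 H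
    exact Or.inr ⟨h1.symm, by rw [h2]; exact WithTop.coe_le_coe.2 (hᵢ.live_le _ _ _ h3)⟩

theorem isAlternationFree_composed (hₒ : IsAlternationFree liveₒ Rₒ)
    (hᵢ : IsAlternationFree liveᵢ Rᵢ) :
    IsAlternationFree (composedLive liveₒ liveᵢ) (composedRel liveₒ Rₒ liveᵢ Rᵢ) where
  strictMono := by
    intro p q hpq
    rw [composedColumns_lt]
    simp only [composedLive, ofLex_toLex]
    rcases Prod.Lex.lt_iff.1 hpq with h | h
    · exact Or.inl (hₒ.strictMono h)
    · exact Or.inr ⟨by rw [h.1], WithTop.coe_lt_coe.2 (hᵢ.strictMono h.2)⟩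
  rel_live := by
    intro p s
    cases s with
    | top => exact Or.inr ⟨rfl, rfl⟩
    | coe s => exact ⟨rfl, _, rfl, hᵢ.rel_live _ _⟩
  live_le := fun p s c H => composedLive_le hₒ hᵢ H
  eq_of_rel_live := by
    intro p s q H
    have key : (ofLex p).1 = (ofLex q).1 ∧ (ofLex p).2 = (ofLex q).2 := by
      cases s with
      | top =>
        rcases composedRel_top.1 H with ⟨h, -⟩ | ⟨h1, h2⟩
        · simp [composedLive] at h
        · simp only [composedLive, ofLex_toLex, WithTop.coe_inj] at h1 h2
          exact ⟨(hₒ.strictMono.injective h1).symm, (hᵢ.strictMono.injective h2).symm⟩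
      | coe s =>
        obtain ⟨h1, d, h2, h3⟩ := composedRel_coe.1 H
        simp only [composedLive, ofLex_toLex, WithTop.coe_inj] at h1 h2
        subst h2
        exact ⟨(hₒ.strictMono.injective h1).symm, hᵢ.eq_of_rel_live _ _ _ h3⟩
    exact ofLex.injective (Prod.ext key.1 key.2)
  avoid := by
    intro p s q t c₁ c₂ c₃ c₄ hlt h1 h2 h3 h4 h12 h23 h34
    have hs1 := (composedLive_le hₒ hᵢ h1).trans h12
    have x12 : (ofLex c₁.1).1 ≤ (ofLex c₂.1).1 := Prod.Lex.monotone_fst _ _ h12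
    have x23 : (ofLex c₂.1).1 ≤ (ofLex c₃.1).1 := Prod.Lex.monotone_fst _ _ h23.le
    have x34 : (ofLex c₃.1).1 ≤ (ofLex c₄.1).1 := Prod.Lex.monotone_fst _ _ h34.le
    cases s with
    | top =>
      cases t with
      | top =>
        have hlt' : (ofLex q).1 < (ofLex p).1 ∨
            ((ofLex q).1 = (ofLex p).1 ∧ (ofLex q).2 < (ofLex p).2) := by
          rcases hlt with h | ⟨-, h⟩
          · exact Prod.Lex.lt_iff.1 h
          · exact absurd h (lt_irrefl _)
        have r1 := composedRel_top_outer hₒ h1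
        have r3 := composedRel_top_outer hₒ h3
        rcases x23.lt_or_eq with x23' | x23'
        · rcases x34.lt_or_eq with x34' | x34'
          · exact hₒ.avoid _ _ _ _ _ _ _ _ hlt' r1 (composedRel_top_outer hₒ h2) r3
              (composedRel_top_outer hₒ h4) x12 x23' x34'
          -- Here `c₃` lies in the block where row `p` begins, although `p` already has a one at
          -- `c₁`, in an earlier block.
          · obtain ⟨e, -⟩ := composedRel_top_of_lt h3 h34 x34'.symm
            have := hₒ.live_le _ _ _ r1
            rw [← e] at this
            exact (this.trans x12).not_gt x23'
        -- Now `c₂` is where row `q` begins and `p` starts in the same block no later, contrary to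
        -- the order in which new rows begin.
        · obtain ⟨e1, e2⟩ := composedRel_top_of_lt h2 h23 x23'.symm
          rw [← x23', e1] at r3
          have e3 := hₒ.eq_of_rel_live _ _ _ r3
          rw [composedColumns_le, e1, e2] at hs1
          simp only [composedLive, ofLex_toLex, e3, lt_irrefl, true_and, false_or,
            WithTop.coe_le_coe, hᵢ.strictMono.le_iff_le] at hs1 hlt'
          exact hs1.not_gt hlt'
      | coe t =>
        -- An inner row stays in one block, so `c₃`, lying between two of its ones, is the beginning
        -- of `p`; yet `p` has an earlier one.
        have e2 := (composedRel_coe.1 h2).1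
        have e4 := (composedRel_coe.1 h4).1
        have e3 : (ofLex c₄.1).1 = (ofLex c₃.1).1 := le_antisymm (by rw [e4, ← e2]; exact x23) x34
        obtain ⟨f1, f2⟩ := composedRel_top_of_lt h3 h34 e3
        have : c₃ = composedLive liveₒ liveᵢ p :=
          Subtype.ext (ofLex.injective (Prod.ext f1 f2))
        rw [← this] at hs1
        exact hs1.not_gt h23
    | coe s =>
      obtain ⟨e1, d1, g1, r1⟩ := composedRel_coe.1 h1
      obtain ⟨e3, d3, g3, r3⟩ := composedRel_coe.1 h3
      have e2 : (ofLex c₃.1).1 = (ofLex c₂.1).1 := le_antisymm (by rw [e3, ← e1]; exact x12) x23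
      have k12 : (ofLex c₁.1).2 ≤ (ofLex c₂.1).2 := by
        rcases composedColumns_le.1 h12 with h | h
        · rw [e1, ← e2, e3] at h; exact absurd h (lt_irrefl _)
        · exact h.2
      have k23 : (ofLex c₂.1).2 < (ofLex c₃.1).2 := by
        rcases composedColumns_lt.1 h23 with h | h
        · rw [e2] at h; exact absurd h (lt_irrefl _)
        · exact h.2
      cases t with
      | top =>
        -- The outer row `q` begins at `c₂`, not before the live column of `p`. With `⊤` ordered
        -- last among rows of the same live column, `q` cannot precede `p`.
        obtain ⟨f1, f2⟩ := composedRel_top_of_lt h2 h23 e2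
        have e : (ofLex q).1 = (ofLex p).1 := hₒ.strictMono.injective (by rw [← f1, ← e2, e3])
        rw [g1, f2, WithTop.coe_le_coe] at k12
        have := hᵢ.strictMono.le_iff_le.1 ((hᵢ.live_le _ _ _ r1).trans k12)
        rcases hlt with h | ⟨-, h⟩
        · rcases Prod.Lex.lt_iff.1 h with h | h
          · exact h.ne e
          · exact h.2.not_ge this
        · exact not_top_lt h
      | coe t =>
        obtain ⟨e2', d2, g2, r2⟩ := composedRel_coe.1 h2
        obtain ⟨e4, d4, g4, r4⟩ := composedRel_coe.1 h4
        have e : (ofLex q).1 = (ofLex p).1 := hₒ.strictMono.injective (by rw [← e2', ← e2, e3])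
        have k34 : (ofLex c₃.1).2 < (ofLex c₄.1).2 := by
          rcases composedColumns_lt.1 h34 with h | h
          · rw [e3, e4, e] at h; exact absurd h (lt_irrefl _)
          · exact h.2
        rw [g1, g2, WithTop.coe_le_coe] at k12
        rw [g2, g3, WithTop.coe_lt_coe] at k23
        rw [g3, g4, WithTop.coe_lt_coe] at k34
        refine hᵢ.avoid _ _ _ _ _ _ _ _ ?_ r1 r2 r3 r4 k12 k23 k34
        rcases hlt with h | ⟨rfl, h⟩
        · rcases Prod.Lex.lt_iff.1 h with h | h
          · exact absurd e h.ne
          · exact Or.inl h.2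
        · exact Or.inr ⟨rfl, WithTop.coe_lt_coe.1 h⟩

theorem card_composedColumns [Fintype Λₒ] [Fintype Cₒ] [Fintype Cᵢ] :
    Nat.card (ComposedColumns liveₒ Cᵢ) ≤
      Fintype.card Cₒ + Fintype.card Λₒ * Fintype.card Cᵢ := by
  have : Fintype.card Cₒ + Fintype.card Λₒ * Fintype.card Cᵢ = Nat.card (Cₒ ⊕ Λₒ × Cᵢ) := by
    simp [Nat.card_eq_fintype_card]
  rw [this]
  refine Nat.card_le_card_of_surjective (fun z => match z with
    | Sum.inl c => (⟨toLex (c, ⊤), Or.inl rfl⟩ : ComposedColumns liveₒ Cᵢ)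
    | Sum.inr (i, d) => ⟨toLex (liveₒ i, (d : WithTop Cᵢ)), Or.inr ⟨i, rfl⟩⟩) ?_
  rintro ⟨⟨c, κ⟩, h⟩
  cases κ with
  | top => exact ⟨Sum.inl c, rfl⟩
  | coe d =>
    rcases h with h | ⟨i, h⟩
    · exact absurd h (WithTop.coe_ne_top)
    · exact ⟨Sum.inr (i, d), Subtype.ext (congrArg (fun x => toLex (x, (d : WithTop Cᵢ))) h.symm)⟩

/-- Outer rows gain one new beginning, which raises their degree from `d` to `d + 1`; inner rows
have degree `d + 1` already. -/
theorem degree_composedRel [Fintype Cₒ] [Fintype Cᵢ] {d : ℕ}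
    (hdₒ : ∀ i s, d ≤ Nat.card {c // Rₒ i s c}) (hdᵢ : ∀ i s, d + 1 ≤ Nat.card {c // Rᵢ i s c})
    (p : Λₒ ×ₗ Λᵢ) (s : WithTop J) :
    d + 1 ≤ Nat.card {c // composedRel liveₒ Rₒ liveᵢ Rᵢ p s c} := by
  cases s with
  | top =>
    have : Nat.card (Option {c // Rₒ (ofLex p).1 (ofLex p).2 c}) ≤
        Nat.card {c // composedRel liveₒ Rₒ liveᵢ Rᵢ p ⊤ c} := by
      refine Nat.card_le_card_of_injective (fun z => match z with
        | none => ⟨composedLive liveₒ liveᵢ p, Or.inr ⟨rfl, rfl⟩⟩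
        | some c => ⟨⟨toLex (c.1, ⊤), Or.inl rfl⟩, Or.inl ⟨rfl, c.2⟩⟩) ?_
      rintro (_ | ⟨c, hc⟩) (_ | ⟨c', hc'⟩) H
      · rfl
      · have := congrArg (fun z => (ofLex z.1.1).2) H
        simp [composedLive] at this
      · have := congrArg (fun z => (ofLex z.1.1).2) H
        simp [composedLive] at this
      · have := congrArg (fun z => (ofLex z.1.1).1) H
        simpa using this
    refine le_trans ?_ this
    rw [Finite.card_option]
    exact Nat.succ_le_succ (hdₒ _ _)
  | coe s =>
    refine (hdᵢ (ofLex p).2 s).trans (Nat.card_le_card_of_injective (fun z =>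
      ⟨⟨toLex (liveₒ (ofLex p).1, (z.1 : WithTop Cᵢ)), Or.inr ⟨_, rfl⟩⟩,
        composedRel_coe.2 ⟨rfl, z.1, rfl, z.2⟩⟩) ?_)
    rintro ⟨c, hc⟩ ⟨c', hc'⟩ H
    have := congrArg (fun z => (ofLex z.1.1).2) H
    simpa using this

end Composition


/-! ### Dense alternation-free relations -/

/-- There is an alternation-free relation with at least `L` live columns, in which every row has at
least `d` columns and there are at most `b` columns for each live column. -/
def ExistsAlternationFree (d : ℕ) (J : Type) [LinearOrder J] (L : ℕ) (b : ℝ) : Prop :=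
  ∃ (Λ C : Type) (_ : LinearOrder Λ) (_ : Fintype Λ) (_ : LinearOrder C) (_ : Fintype C)
    (live : Λ → C) (R : Λ → J → C → Prop), IsAlternationFree live R ∧
    (∀ i s, d ≤ Nat.card {c // R i s c}) ∧ 0 < Fintype.card Λ ∧ L ≤ Fintype.card Λ ∧
    (Fintype.card C : ℝ) ≤ b * Fintype.card Λ

theorem ExistsAlternationFree.congr {d L : ℕ} {b : ℝ} {J J' : Type} [LinearOrder J]
    [LinearOrder J'] (e : J' ≃o J) (H : ExistsAlternationFree d J L b) :
    ExistsAlternationFree d J' L b := by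
  obtain ⟨Λ, C, _, _, _, _, live, R, hR, hd, hpos, hL, hb⟩ := H
  refine ⟨Λ, C, inferInstance, inferInstance, inferInstance, inferInstance, live,
    fun i s c => R i (e s) c, ⟨hR.strictMono, fun i s => hR.rel_live _ _,
    fun i s c => hR.live_le _ _ _, fun i s j => hR.eq_of_rel_live _ _ _, ?_⟩,
    fun i s => hd _ _, hpos, hL, hb⟩
  intro i s j t c₁ c₂ c₃ c₄ hlt
  refine hR.avoid i (e s) j (e t) c₁ c₂ c₃ c₄ ?_
  simpa using hlt

/-- The induction on `m` composes an outer relation of degree `d` with the inner one of degree `d +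
1`. Each step adds one row per live column at a cost of at most `(1 + c) / 2` columns per live
column. -/
theorem existsAlternationFree_succ {d : ℕ}
    (ih : ∀ c : ℝ, 1 < c → ∃ m₀ : ℕ, ∀ m ≥ m₀, ExistsAlternationFree d (Fin m) 0 (c * m))
    (c : ℝ) (hc : 1 < c) :
    ∃ m₀ : ℕ, ∀ m ≥ m₀, ExistsAlternationFree (d + 1) (Fin m) 0 (c * m) := by
  -- A slope strictly between `1` and `c` leaves room to absorb the initial `1` once `m ≥ 2 / (c -
  -- 1)`. The bound `L` on live columns is carried so that the outer relation, whose rows per live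
  -- column are indexed by `Λᵢ`, is available.
  obtain ⟨L, hL⟩ := ih ((1 + c) / 2) (by linarith)
  have inner : ∀ m : ℕ, ExistsAlternationFree (d + 1) (Fin m) L (1 + (1 + c) / 2 * m) := by
    intro m
    induction m with
    | zero =>
      refine ⟨Fin (L + 1), Fin (L + 1), inferInstance, inferInstance, inferInstance, inferInstance,
        id, fun _ _ _ => False, ⟨strictMono_id, fun _ s => s.elim0, fun _ s => s.elim0,
        fun _ s => s.elim0, fun _ s => s.elim0⟩, fun _ s => s.elim0, by simp, by simp, by simp⟩
    | succ m ihm =>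
      obtain ⟨Λᵢ, Cᵢ, _, _, _, _, liveᵢ, Rᵢ, hᵢ, hdᵢ, hposᵢ, hLᵢ, hbᵢ⟩ := ihm
      obtain ⟨Λₒ, Cₒ, _, _, _, _, liveₒ, Rₒ, hₒ, hdₒ, hposₒ, -, hbₒ⟩ :=
        (hL _ hLᵢ).congr (Fintype.orderIsoFinOfCardEq Λᵢ rfl).symm
      have hcard := card_composedColumns (liveₒ := liveₒ) (Cᵢ := Cᵢ)
      have e : Fin (m + 1) ≃o WithTop (Fin m) :=
        Fintype.orderIsoFinOfCardEq _ (by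
          rw [← Nat.card_eq_fintype_card]
          exact (Finite.card_option (α := Fin m)).trans (by simp))
      refine ExistsAlternationFree.congr e ⟨Λₒ ×ₗ Λᵢ, ComposedColumns liveₒ Cᵢ, inferInstance,
        inferInstance, inferInstance, inferInstance, _, _,
        isAlternationFree_composed hₒ hᵢ, degree_composedRel hdₒ hdᵢ, ?_, ?_, ?_⟩
      · rw [Fintype.card_lex, Fintype.card_prod]; positivity
      · rw [Fintype.card_lex, Fintype.card_prod]; nlinarith
      · rw [Fintype.card_lex, Fintype.card_prod, ← Nat.card_eq_fintype_card]
        have h1 : (Nat.card (ComposedColumns liveₒ Cᵢ) : ℝ) ≤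
            Fintype.card Cₒ + Fintype.card Λₒ * Fintype.card Cᵢ := by exact_mod_cast hcard
        have h2 : (Fintype.card Λₒ : ℝ) * Fintype.card Cᵢ ≤
            Fintype.card Λₒ * ((1 + (1 + c) / 2 * m) * Fintype.card Λᵢ) := by gcongr
        push_cast
        linarith
  obtain ⟨N, hN⟩ := exists_nat_ge (2 / (c - 1))
  refine ⟨N, fun m hm => ?_⟩
  obtain ⟨Λ, C, _, _, _, _, live, R, hR, hd, hpos, -, hb⟩ := inner m
  refine ⟨Λ, C, inferInstance, inferInstance, inferInstance, inferInstance, live, R, hR, hd, hpos,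
    Nat.zero_le _, hb.trans ?_⟩
  gcongr
  have hm' : 2 / (c - 1) ≤ m := hN.trans (by exact_mod_cast hm)
  rw [div_le_iff₀ (by linarith)] at hm'
  linarith

theorem existsAlternationFree (d : ℕ) (c : ℝ) (hc : 1 < c) :
    ∃ m₀ : ℕ, ∀ m ≥ m₀, ExistsAlternationFree d (Fin m) 0 (c * m) := by
  induction d generalizing c with
  | succ d ih => exact existsAlternationFree_succ ih c hc
  | zero =>
    refine ⟨1, fun m hm => ⟨Fin 1, Fin 1, inferInstance, inferInstance, inferInstance,
      inferInstance, id, fun _ _ _ => True, ⟨strictMono_id, fun _ _ => trivial,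
      fun i _ c _ => (Subsingleton.elim i c).le, fun _ _ _ _ => Subsingleton.elim _ _, ?_⟩,
      fun _ _ => Nat.zero_le _, by simp, by simp, ?_⟩⟩
    · intro _ _ _ _ _ c₂ c₃ _ _ _ _ _ _ _ h
      exact absurd (Subsingleton.elim c₂ c₃) h.ne
    · have : (1 : ℝ) ≤ m := by exact_mod_cast hm
      simp only [Fintype.card_fin, Nat.cast_one, mul_one]
      nlinarith

theorem superlinear_of_alternationFree {h w : ℕ} {P : ZeroOneMatrix h w}
    (hrow : ∀ i, ∃ j, P i j = 1) (hcol : ∀ j, ∃ i, P i j = 1)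
    (hconn : ∀ (f : Fin h → ℕ) (g : Fin w → ℕ), Monotone f → Monotone g →
      (∀ i j, P i j = 1 → f i = g j) → ∃ k, (∀ i, f i = k) ∧ ∀ j, g j = k)
    (hav : ∀ (Λ J C : Type) [LinearOrder Λ] [LinearOrder J] [LinearOrder C] (live : Λ → C)
      (R : Λ → J → C → Prop), IsAlternationFree live R →
      ∀ (r : Fin h → Λ ×ₗ J) (c : Fin w → C), StrictMono r → StrictMono c →
      (∀ i j, P i j = 1 → R (ofLex (r i)).1 (ofLex (r i)).2 (c j)) → False) :
    P.Superlinear := by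
  refine superlinear_of_dense hrow hcol hconn fun K => ?_
  -- Columns are at most twice the rows, so degree `3 * K` pays for `K` ones per row and per column.
  obtain ⟨m₀, hm₀⟩ := existsAlternationFree (3 * K) 2 (by norm_num)
  obtain ⟨Λ, C, _, _, _, _, live, R, hR, hd, hpos, -, hb⟩ := hm₀ (m₀ + 1) (by omega)
  refine ⟨Λ ×ₗ Fin (m₀ + 1), C, inferInstance, inferInstance, inferInstance, inferInstance,
    fun x c => R (ofLex x).1 (ofLex x).2 c, ?_, ?_, ?_⟩
  · rw [Fintype.card_lex, Fintype.card_prod, Fintype.card_fin]; positivity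
  · rintro ⟨r, c, hr, hc, hrc⟩
    exact hav _ _ _ live R hR r c hr hc hrc
  · have h1 : Fintype.card C ≤ 2 * Fintype.card (Λ ×ₗ Fin (m₀ + 1)) := by
      rw [Fintype.card_lex, Fintype.card_prod, Fintype.card_fin]
      have : (Fintype.card C : ℝ) ≤ (2 * (Fintype.card Λ * (m₀ + 1)) : ℕ) := by
        push_cast at hb ⊢
        linarith
      exact_mod_cast this
    rw [Nat.card_congr (Equiv.subtypeProdEquivSigmaSubtype
      fun (x : Λ ×ₗ Fin (m₀ + 1)) c => R (ofLex x).1 (ofLex x).2 c), Nat.card_sigma]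
    calc K * (Fintype.card (Λ ×ₗ Fin (m₀ + 1)) + Fintype.card C)
        ≤ K * (3 * Fintype.card (Λ ×ₗ Fin (m₀ + 1))) := Nat.mul_le_mul_left K (by omega)
      _ = ∑ x : Λ ×ₗ Fin (m₀ + 1), 3 * K := by
        rw [Finset.sum_const, Finset.card_univ, smul_eq_mul]; ring
      _ ≤ _ := Finset.sum_le_sum fun x _ => hd _ _

theorem superlinear_alternation : Superlinear !![0, 1, 0, 1; 1, 0, 1, 0] := by
  refine superlinear_of_alternationFree ?_ ?_ ?_ ?_
  · intro i
    fin_cases i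
    exacts [⟨1, rfl⟩, ⟨0, rfl⟩]
  · intro j
    fin_cases j
    exacts [⟨1, rfl⟩, ⟨0, rfl⟩, ⟨1, rfl⟩, ⟨0, rfl⟩]
  · intro f g hf hg H
    have h1 := H 0 1 rfl
    have h2 := H 0 3 rfl
    have h3 := H 1 0 rfl
    have h4 := H 1 2 rfl
    have hg1 := hg (show (0 : Fin 4) ≤ 1 by decide)
    have hg2 := hg (show (1 : Fin 4) ≤ 2 by decide)
    have hg3 := hg (show (2 : Fin 4) ≤ 3 by decide)
    refine ⟨f 0, fun i => ?_, fun j => ?_⟩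
    · (fin_cases i <;> simp); omega
    · fin_cases j <;> (simp; omega)
  · intro Λ J C _ _ _ live R hR r c hr hc hrc
    exact hR.avoid _ _ _ _ _ _ _ _ (Prod.Lex.lt_iff.1 (hr (show (0 : Fin 2) < 1 by decide)))
      (hrc 1 0 rfl) (hrc 0 1 rfl) (hrc 1 2 rfl) (hrc 0 3 rfl)
      (hc (show (0 : Fin 4) < 1 by decide)).le (hc (show (1 : Fin 4) < 2 by decide))
      (hc (show (2 : Fin 4) < 3 by decide))

/-- After a top-bottom reflection, the first column serves only to bound the beginning of the middle
row: that row begins no later than the last row, hence before column `1`. Its live column then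
completes an alternation with row `0`. -/
theorem superlinear_S2 : Superlinear patternS2 := by
  have key : Superlinear (patternS2.submatrix Fin.rev id) := by
    refine superlinear_of_alternationFree ?_ ?_ ?_ ?_
    · intro i
      fin_cases i
      exacts [⟨1, rfl⟩, ⟨2, rfl⟩, ⟨0, rfl⟩]
    · intro j
      fin_cases j
      exacts [⟨2, rfl⟩, ⟨0, rfl⟩, ⟨1, rfl⟩, ⟨0, rfl⟩]
    · intro f g hf hg H
      have h1 := H 0 1 rfl
      have h2 := H 0 3 rfl
      have h3 := H 1 2 rfl
      have h4 := H 2 0 rfl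
      have hf1 := hf (show (0 : Fin 3) ≤ 1 by decide)
      have hf2 := hf (show (1 : Fin 3) ≤ 2 by decide)
      have hg1 := hg (show (0 : Fin 4) ≤ 1 by decide)
      have hg2 := hg (show (1 : Fin 4) ≤ 2 by decide)
      have hg3 := hg (show (2 : Fin 4) ≤ 3 by decide)
      refine ⟨f 0, fun i => ?_, fun j => ?_⟩
      · fin_cases i <;> simp <;> omega
      · fin_cases j <;> (simp; omega)
    · intro Λ J C _ _ _ live R hR r c hr hc hrc
      have hle : live (ofLex (r 1)).1 ≤ c 0 :=
        (hR.strictMono.monotone (Prod.Lex.monotone_fst _ _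
          (hr (show (1 : Fin 3) < 2 by decide)).le)).trans (hR.live_le _ _ _ (hrc 2 0 rfl))
      exact hR.avoid _ _ _ _ _ _ _ _ (Prod.Lex.lt_iff.1 (hr (show (0 : Fin 3) < 1 by decide)))
        (hR.rel_live _ _) (hrc 0 1 rfl) (hrc 1 2 rfl) (hrc 0 3 rfl)
        (hle.trans (hc (show (0 : Fin 4) < 1 by decide)).le)
        (hc (show (1 : Fin 4) < 2 by decide)) (hc (show (2 : Fin 4) < 3 by decide))
  simpa only [reflect_rows_twice] using key.reflect_rows

/-! ### Operations that preserve linearity -/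

theorem linearlyBounded_of_height_le_one {h w : ℕ} (M : ZeroOneMatrix h w) (hh : h ≤ 1) :
    M.LinearlyBounded := by
  classical
  refine linearlyBounded_of_le w fun n => ex_le fun A hA => ?_
  have key : ∀ i : Fin n, (Finset.univ.filter fun j => A i j = 1).card ≤ w := by
    intro i
    by_contra! hlt
    let c := Finset.orderEmbOfCardLe (Finset.univ.filter fun j => A i j = 1) hlt.le
    refine hA ⟨OrderEmbedding.ofStrictMono (fun _ => i) fun a b hab => ?_, c, fun a b _ => ?_⟩
    · have := a.2; have := b.2; rw [Fin.lt_def] at hab; omega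
    · have : c b ∈ Finset.univ.filter fun j => A i j = 1 := Finset.orderEmbOfCardLe_mem _ _ b
      exact (Finset.mem_filter.1 this).2
  have : ones A = ∑ i : Fin n, (Finset.univ.filter fun j => A i j = 1).card := by
    simp only [ones, Finset.card_filter]
    rw [Fintype.sum_prod_type]
  rw [this, mul_comm]
  calc _ ≤ ∑ i : Fin n, w := Finset.sum_le_sum fun i _ => key i
    _ = n * w := by simp

theorem MinimallyNonlinear.not_linearlyBounded {h w : ℕ} {M : ZeroOneMatrix h w}
    (hM : M.MinimallyNonlinear) : ¬ M.LinearlyBounded :=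
  Superlinear.not_linearlyBounded hM.1

theorem MinimallyNonlinear.two_le_height {h w : ℕ} {M : ZeroOneMatrix h w}
    (hM : M.MinimallyNonlinear) : 2 ≤ h := by
  by_contra! hlt
  exact hM.not_linearlyBounded (linearlyBounded_of_height_le_one M (by omega))

theorem ones_le_ones_submatrix_succ {m : ℕ} (A : ZeroOneMatrix (m + 1) (m + 1)) :
    ones A ≤ ones (A.submatrix Fin.succ Fin.succ) + 2 * (m + 1) := by
  classical
  have hsub : (Finset.univ.filter fun p : Fin (m + 1) × Fin (m + 1) => A p.1 p.2 = 1) ⊆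
      ((Finset.univ.filter fun p : Fin m × Fin m =>
        A.submatrix Fin.succ Fin.succ p.1 p.2 = 1).image fun p => (p.1.succ, p.2.succ)) ∪
      ((Finset.univ.image fun j : Fin (m + 1) => ((0 : Fin (m + 1)), j)) ∪
        Finset.univ.image fun i : Fin (m + 1) => (i, (0 : Fin (m + 1)))) := by
    rintro ⟨i, j⟩ hij
    have hij' : A i j = 1 := (Finset.mem_filter.1 hij).2
    simp only [Finset.mem_union]
    induction i using Fin.cases with
    | zero => exact Or.inr (Or.inl (Finset.mem_image_of_mem _ (Finset.mem_univ _)))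
    | succ i =>
      induction j using Fin.cases with
      | zero => exact Or.inr (Or.inr (Finset.mem_image_of_mem _ (Finset.mem_univ _)))
      | succ j =>
        exact Or.inl (Finset.mem_image.2 ⟨(i, j), Finset.mem_filter.2 ⟨Finset.mem_univ _, hij'⟩,
          rfl⟩)
  refine (Finset.card_le_card hsub).trans ((Finset.card_union_le _ _).trans ?_)
  refine Nat.add_le_add Finset.card_image_le ((Finset.card_union_le _ _).trans ?_)
  have h1 := Finset.card_image_le (s := Finset.univ) (f := fun j : Fin (m + 1) =>
    ((0 : Fin (m + 1)), j))
  have h2 := Finset.card_image_le (s := Finset.univ) (f := fun i : Fin (m + 1) =>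
    (i, (0 : Fin (m + 1))))
  rw [Finset.card_univ, Fintype.card_fin] at h1 h2
  omega

/-- The first row of the host matrix can always play the empty top row. The first column is dropped
as well only to keep the matrix square. -/
theorem linearlyBounded_of_top_row_empty {h w : ℕ} {M : ZeroOneMatrix (h + 1) w}
    (htop : ∀ j, M 0 j ≠ 1)
    (hM : LinearlyBounded (M.submatrix Fin.succ id : ZeroOneMatrix h w)) :
    M.LinearlyBounded := by
  have hle : ∀ m, ex (m + 1) M ≤
      ex m (M.submatrix Fin.succ id : ZeroOneMatrix h w) + 2 * (m + 1) := by
    refine fun m => ex_le fun A hA => ?_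
    refine (ones_le_ones_submatrix_succ A).trans (Nat.add_le_add_right (ones_le_ex ?_) _)
    rintro ⟨r, c, hrc⟩
    refine hA ⟨OrderEmbedding.ofStrictMono (Fin.cons 0 fun i => (r i).succ) ?_,
      OrderEmbedding.ofStrictMono (fun j => (c j).succ) fun a b hab => by simpa using hab, ?_⟩
    · intro a b hab
      induction a using Fin.cases with
      | zero =>
        induction b using Fin.cases with
        | zero => exact absurd hab (lt_irrefl _)
        | succ b => simp
      | succ a =>
        induction b using Fin.cases with
        | zero => exact absurd hab (Fin.not_lt_zero _)
        | succ b => simpa using hab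
    · intro i j hij
      induction i using Fin.cases with
      | zero => exact absurd hij (htop j)
      | succ i => exact hrc i j hij
  obtain ⟨K, hK⟩ := hM.bound
  obtain ⟨N, hN⟩ := Filter.eventually_atTop.1 hK
  -- The constant `K` might be negative, and the `2` pays for the dropped row and column.
  refine Asymptotics.IsBigO.of_bound (max K 0 + 2) ?_
  filter_upwards [Filter.eventually_ge_atTop (N + 1)] with n hn
  obtain ⟨m, rfl⟩ : ∃ m, n = m + 1 := ⟨n - 1, by omega⟩
  have h1 := hN m (by omega)
  have h2 : (ex (m + 1) M : ℝ) ≤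
      ex m (M.submatrix Fin.succ id : ZeroOneMatrix h w) + 2 * (m + 1) := by
    exact_mod_cast hle m
  simp only [Real.norm_natCast] at h1 ⊢
  have h3 : K * (m : ℝ) ≤ max K 0 * m := by gcongr; exact le_max_left _ _
  have h4 := le_max_right K 0
  push_cast
  linarith

theorem MinimallyNonlinear.exists_top_one {h w : ℕ} {M : ZeroOneMatrix h w}
    (hM : M.MinimallyNonlinear) : M.topOnes.Nonempty := by
  obtain ⟨h, rfl⟩ : ∃ k, h = k + 1 := ⟨h - 1, by have := hM.two_le_height; omega⟩
  by_contra hne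
  have htop : ∀ j, M 0 j ≠ 1 := fun j hj => hne ⟨j, 0, rfl, hj⟩
  refine hM.not_linearlyBounded (linearlyBounded_of_top_row_empty htop
    (hM.2 _ _ _ ⟨Fin.succOrderEmb h, RelEmbedding.refl _, fun i j hij => hij⟩ ?_))
  intro heq
  have := congrArg Sigma.fst heq
  simp at this

theorem MinimallyNonlinear.reflect_rows {h w : ℕ} {M : ZeroOneMatrix h w}
    (hM : M.MinimallyNonlinear) : MinimallyNonlinear (M.submatrix Fin.rev id) := by
  refine ⟨Superlinear.reflect_rows hM.1, fun h' w' P' hc hne => ?_⟩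
  have hc' := hc.reflect_rows
  rw [reflect_rows_twice] at hc'
  have := hM.2 _ _ _ hc' ?_
  · simpa only [ex_reflect_rows] using this
  · intro heq
    cases heq
    exact hne (by rw [reflect_rows_twice])

theorem topOnes_reflect_rows {h w : ℕ} (M : ZeroOneMatrix h w) :
    topOnes (M.submatrix Fin.rev id) = M.bottomOnes := by
  ext j
  constructor
  · rintro ⟨i, hi, hij⟩
    exact ⟨i.rev, by rw [Fin.val_rev]; have := i.2; omega, hij⟩
  · rintro ⟨i, hi, hij⟩
    exact ⟨i.rev, by rw [Fin.val_rev]; omega, by simpa using hij⟩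

theorem bottomOnes_reflect_rows {h w : ℕ} (M : ZeroOneMatrix h w) :
    bottomOnes (M.submatrix Fin.rev id) = M.topOnes := by
  rw [← topOnes_reflect_rows, reflect_rows_twice]

theorem MinimallyNonlinear.exists_bottom_one {h w : ℕ} {M : ZeroOneMatrix h w}
    (hM : M.MinimallyNonlinear) : M.bottomOnes.Nonempty := by
  rw [← topOnes_reflect_rows]
  exact hM.reflect_rows.exists_top_one

/-! ### Thinning the rows of a matrix -/

/-- The number of ones in row `i` to the left of column `j`. -/
def rowRank {m n : ℕ} (A : ZeroOneMatrix m n) (i : Fin m) (j : Fin n) : ℕ :=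
  (Finset.univ.filter fun j' => j' < j ∧ A i j' = 1).card

/-- Keep only the ones whose rank in their row is congruent to `t` modulo `q`. -/
def thin {m n : ℕ} (A : ZeroOneMatrix m n) (q t : ℕ) : ZeroOneMatrix m n :=
  fun i j => if A i j = 1 ∧ A.rowRank i j % q = t then 1 else 0

theorem thin_eq_one {m n : ℕ} {A : ZeroOneMatrix m n} {q t : ℕ} {i : Fin m} {j : Fin n} :
    A.thin q t i j = 1 ↔ A i j = 1 ∧ A.rowRank i j % q = t := by
  unfold thin
  split_ifs with h
  · simpa using h
  · simpa using h

theorem ones_eq_sum_thin {m n : ℕ} (A : ZeroOneMatrix m n) {q : ℕ} (hq : 0 < q) :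
    ones A = ∑ t ∈ Finset.range q, ones (A.thin q t) := by
  classical
  unfold ones
  rw [Finset.card_eq_sum_card_fiberwise (f := fun p => A.rowRank p.1 p.2 % q)
    (t := Finset.range q) fun p _ => by simpa using Nat.mod_lt _ hq]
  refine Finset.sum_congr rfl fun t _ => congrArg Finset.card ?_
  ext p
  simp only [Finset.mem_filter, Finset.mem_univ, true_and]
  exact thin_eq_one.symm

/-- The ranks of two kept ones of a row differ by a positive multiple of `q`, so at least `q - 1`
ones were removed between them. -/
theorem le_card_between_of_thin {m n q t : ℕ} {A : ZeroOneMatrix m n} {i : Fin m} {j j' : Fin n}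
    (hlt : j < j') (hj : A.thin q t i j = 1) (hj' : A.thin q t i j' = 1) :
    q ≤ (Finset.univ.filter fun x => (j < x ∧ x < j') ∧ A i x = 1).card + 1 := by
  classical
  rw [thin_eq_one] at hj hj'
  have hrank : A.rowRank i j' = A.rowRank i j +
      ((Finset.univ.filter fun x => (j < x ∧ x < j') ∧ A i x = 1).card + 1) := by
    unfold rowRank
    rw [← Finset.card_insert_of_notMem (a := j) (by simp), ← Finset.card_union_of_disjoint]
    · congr 1
      ext x
      simp only [Finset.mem_filter, Finset.mem_univ, true_and, Finset.mem_union,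
        Finset.mem_insert]
      constructor
      · rintro ⟨h1, h2⟩
        rcases lt_trichotomy x j with h | h | h
        · exact Or.inl ⟨h, h2⟩
        · exact Or.inr (Or.inl h)
        · exact Or.inr (Or.inr ⟨⟨h, h1⟩, h2⟩)
      · rintro (⟨h1, h2⟩ | rfl | ⟨h1, h2⟩)
        · exact ⟨h1.trans hlt, h2⟩
        · exact ⟨hlt, hj.1⟩
        · exact ⟨h1.2, h2⟩
    · rw [Finset.disjoint_left]
      intro x hx hx'
      simp only [Finset.mem_filter, Finset.mem_univ, true_and, Finset.mem_insert] at hx hx'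
      rcases hx' with rfl | hx'
      · exact lt_irrefl _ hx.1
      · exact lt_asymm hx.1 hx'.1.1
  have hmod : A.rowRank i j ≡ A.rowRank i j' [MOD q] := hj.2.trans hj'.2.symm
  have hdvd := (Nat.modEq_iff_dvd' (by omega)).1 hmod
  exact Nat.le_of_dvd (by omega) (by rwa [hrank, Nat.add_sub_cancel_left] at hdvd)

/-- The embedding of columns that skips the `k` columns after column `a`. -/
def skipColumns {w : ℕ} (a k : ℕ) (j : Fin (w - k)) : Fin w :=
  if h : (j : ℕ) ≤ a then ⟨j, by have := j.2; omega⟩ else ⟨j + k, by have := j.2; omega⟩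

theorem val_skipColumns {w : ℕ} (a k : ℕ) (j : Fin (w - k)) :
    (skipColumns a k j : ℕ) = if (j : ℕ) ≤ a then (j : ℕ) else j + k := by
  unfold skipColumns
  split_ifs <;> rfl

theorem strictMono_skipColumns {w : ℕ} (a k : ℕ) :
    StrictMono (skipColumns a k : Fin (w - k) → Fin w) := by
  intro x y hxy
  rw [Fin.lt_def] at hxy ⊢
  rw [val_skipColumns, val_skipColumns]
  split_ifs <;> omega

/-- The `k` deleted columns have ones only in row `i`, and thinning modulo `k + 1` guarantees `k`
ones of `A` in the matching row between the images of `a` and `b`, where those columns can be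
reinserted. -/
theorem contains_of_thin_contains {n h w k q t : ℕ} {M : ZeroOneMatrix h w} {i : Fin h}
    {a b : Fin w} (hgap : (a : ℕ) + k + 1 = b) (hq : q = k + 1) (ha : M i a = 1) (hb : M i b = 1)
    (hbetween : ∀ l j, a < j → j < b → M l j = 1 → l = i) {A : ZeroOneMatrix n n}
    (H : (A.thin q t).Contains
      (M.submatrix id (skipColumns a k) : ZeroOneMatrix h (w - k))) : A.Contains M := by
  classical
  obtain ⟨r, c, hrc⟩ := H
  have hbw := b.2
  let p : Fin (w - k) := ⟨a, by omega⟩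
  -- After the deletion, column `b` has index `a + 1`.
  let p' : Fin (w - k) := ⟨a + 1, by omega⟩
  have hp : skipColumns a k p = a := Fin.ext (by rw [val_skipColumns]; simp [p])
  have hp' : skipColumns a k p' = b := Fin.ext (by rw [val_skipColumns]; simp [p']; omega)
  have h1 := hrc i p (by simpa [hp] using ha)
  have h2 := hrc i p' (by simpa [hp'] using hb)
  have hcard := le_card_between_of_thin
    (c.strictMono (show p < p' by rw [Fin.lt_def]; simp [p, p'])) h1 h2
  let e := Finset.orderEmbOfCardLe (k := k)
    (Finset.univ.filter fun x => (c p < x ∧ x < c p') ∧ A (r i) x = 1) (by omega)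
  have he : ∀ x, (c p < e x ∧ e x < c p') ∧ A (r i) (e x) = 1 := fun x => by
    have : e x ∈ Finset.univ.filter fun x => (c p < x ∧ x < c p') ∧ A (r i) x = 1 :=
      Finset.orderEmbOfCardLe_mem _ _ x
    exact (Finset.mem_filter.1 this).2
  -- Columns up to `a` and from `b` on follow `c`; those strictly between go to the recovered ones
  -- `e`.
  let f : Fin w → Fin n := fun j =>
    if h1 : j ≤ a then c ⟨j, by rw [Fin.le_def] at h1; omega⟩
    else if h2 : j < b then e ⟨j - a - 1, by rw [Fin.lt_def] at h2; omega⟩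
    else c ⟨j - k, by have := j.2; rw [not_lt, Fin.le_def] at h2; omega⟩
  refine ⟨r, OrderEmbedding.ofStrictMono f ?_, ?_⟩
  · intro x y hxy
    have hx := x.2
    have hy := y.2
    simp only [f]
    rw [Fin.lt_def] at hxy
    by_cases hxa : x ≤ a
    · rw [dif_pos hxa]
      rw [Fin.le_def] at hxa
      split_ifs with h1 h2
      · exact c.strictMono hxy
      · exact lt_of_le_of_lt (c.monotone (by exact hxa)) (he _).1.1
      · rw [not_lt, Fin.le_def] at h2
        exact c.strictMono (by rw [Fin.lt_def]; simp only; omega)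
    · have hya : ¬ y ≤ a := fun h => hxa ((Fin.le_def.2 hxy.le).trans h)
      rw [dif_neg hxa, dif_neg hya]
      rw [Fin.le_def] at hxa hya
      split_ifs with h1 h2 h2
      · exact e.strictMono (by rw [Fin.lt_def]; simp only; omega)
      · rw [not_lt, Fin.le_def] at h2
        exact lt_of_lt_of_le (he _).1.2 (c.monotone (by rw [Fin.le_def]; simp only [p']; omega))
      · rw [Fin.lt_def] at h1 h2
        omega
      · rw [not_lt, Fin.le_def] at h1
        exact c.strictMono (by rw [Fin.lt_def]; simp only; omega)
  · intro l j hlj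
    have hj := j.2
    change A (r l) (f j) = 1
    simp only [f]
    split_ifs with h1 h2
    · refine (thin_eq_one.1 (hrc l _ ?_)).1
      rw [← hlj, Matrix.submatrix_apply]
      congr 1
      apply Fin.ext
      rw [val_skipColumns, if_pos (by exact h1)]
    · rw [hbetween l j (not_le.1 h1) h2 hlj]
      exact (he _).2
    · refine (thin_eq_one.1 (hrc l _ ?_)).1
      rw [← hlj, Matrix.submatrix_apply]
      congr 1
      apply Fin.ext
      rw [not_lt, Fin.le_def] at h2
      rw [val_skipColumns, if_neg (by simp; omega)]
      simp; omega

theorem MinimallyNonlinear.exists_one_between {h w : ℕ} {M : ZeroOneMatrix h w}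
    (hM : M.MinimallyNonlinear) {i : Fin h} {a b : Fin w} (hgap : (a : ℕ) + 2 ≤ b)
    (ha : M i a = 1) (hb : M i b = 1) : ∃ l j, a < j ∧ j < b ∧ M l j = 1 ∧ l ≠ i := by
  by_contra! hno
  obtain ⟨k, hk⟩ : ∃ k, (a : ℕ) + k + 1 = b := ⟨b - a - 1, by omega⟩
  have hbw := b.2
  have hlin : LinearlyBounded (M.submatrix id (skipColumns a k) : ZeroOneMatrix h (w - k)) := by
    refine hM.2 _ _ _ ⟨RelEmbedding.refl _,
      OrderEmbedding.ofStrictMono _ (strictMono_skipColumns a k), fun _ _ hij => hij⟩ ?_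
    intro heq
    have : w - k = w := congrArg (fun x : SizedZeroOneMatrix => x.2.1) heq
    omega
  refine hM.not_linearlyBounded (Asymptotics.IsBigO.trans (Asymptotics.IsBigO.of_bound (k + 1 : ℕ)
    (Filter.Eventually.of_forall fun n => ?_)) hlin)
  simp only [Real.norm_natCast]
  have : ex n M ≤ (k + 1) * ex n (M.submatrix id (skipColumns a k) : ZeroOneMatrix h (w - k)) := by
    refine ex_le fun A hA => ?_
    rw [ones_eq_sum_thin A (Nat.succ_pos k)]
    refine (Finset.sum_le_card_nsmul _ _ _ fun t _ => ones_le_ex fun H =>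
      hA (contains_of_thin_contains hk rfl ha hb ?_ H)).trans (by simp)
    exact fun l j h1 h2 h3 => hno l j h1 h2 h3
  exact_mod_cast this

/-! ### Consecutive ones in the top and bottom rows -/

theorem contains_of_strictMono {m n h w : ℕ} {A : ZeroOneMatrix m n} {P : ZeroOneMatrix h w}
    {r : Fin h → Fin m} {c : Fin w → Fin n} (hr : StrictMono r) (hc : StrictMono c)
    (H : ∀ i j, P i j = 1 → A (r i) (c j) = 1) : A.Contains P :=
  ⟨OrderEmbedding.ofStrictMono r hr, OrderEmbedding.ofStrictMono c hc, H⟩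

theorem strictMono_vec_two {n : ℕ} {a b : Fin n} (h : a < b) : StrictMono ![a, b] := by
  rw [Fin.strictMono_iff_lt_succ]
  intro i
  fin_cases i
  exact h

theorem strictMono_vec_three {n : ℕ} {a b c : Fin n} (h : a < b) (h' : b < c) :
    StrictMono ![a, b, c] := by
  rw [Fin.strictMono_iff_lt_succ]
  intro i
  fin_cases i
  exacts [h, h']

theorem strictMono_vec_four {n : ℕ} {a b c d : Fin n} (h : a < b) (h' : b < c) (h'' : c < d) :
    StrictMono ![a, b, c, d] := by
  rw [Fin.strictMono_iff_lt_succ]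
  intro i
  fin_cases i
  exacts [h, h', h'']

/-- A one between `t` and `t'` in a middle row, joined with any bottom one `b` outside the open
interval, gives a reflection of `Q₃` when `b` is at an end and of `S₂` when it is beyond. -/
theorem MinimallyNonlinear.exists_bottom_between {h w : ℕ} {M : ZeroOneMatrix h w}
    (hM : M.MinimallyNonlinear)
    (hQ : ∀ A ∈ patternQ3.reflections, (⟨h, w, M⟩ : SizedZeroOneMatrix) ≠ ⟨3, 3, A⟩)
    (hS : ∀ A ∈ patternS2.reflections, (⟨h, w, M⟩ : SizedZeroOneMatrix) ≠ ⟨3, 4, A⟩)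
    {t t' : Fin w} (ht : t ∈ M.topOnes) (ht' : t' ∈ M.topOnes) (hgap : (t : ℕ) + 2 ≤ t') :
    ∃ b ∈ M.bottomOnes, t < b ∧ b < t' := by
  by_contra! hno
  obtain ⟨i, hi, hit⟩ := ht
  obtain ⟨i', hi', hit'⟩ := ht'
  obtain rfl : i = i' := Fin.ext (hi.trans hi'.symm)
  obtain ⟨l, j, htj, hjt', hlj, hli⟩ := hM.exists_one_between hgap hit hit'
  obtain ⟨b, k, hk, hkb⟩ := hM.exists_bottom_one
  have hil : i < l := by
    rw [Fin.lt_def]; have : (l : ℕ) ≠ i := fun h => hli (Fin.ext h); omega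
  have hlk : l < k := by
    rw [Fin.lt_def]
    have h1 := l.2
    have h2 : (l : ℕ) + 1 ≠ h := fun h2 =>
      absurd (hno j ⟨l, h2, hlj⟩ htj) (not_le.2 hjt')
    omega
  have hr := strictMono_vec_three hil hlk
  have nQ : ∀ A ∈ patternQ3.reflections, ¬ M.Contains A := fun A hA hc =>
    hQ A hA (hM.eq_of_contains (superlinear_Q3.of_mem_reflections hA) hc)
  have nS : ∀ A ∈ patternS2.reflections, ¬ M.Contains A := fun A hA hc =>
    hS A hA (hM.eq_of_contains (superlinear_S2.of_mem_reflections hA) hc)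
  rcases lt_trichotomy b t with hb | rfl | hb
  · refine nS (patternS2.submatrix Fin.rev id) (by simp [reflections])
      (contains_of_strictMono hr (strictMono_vec_four hb htj hjt') ?_)
    intro x y hxy
    fin_cases x <;> fin_cases y <;> simp_all [patternS2, Fin.rev]
  · refine nQ (patternQ3.submatrix id Fin.rev) (by simp [reflections])
      (contains_of_strictMono hr (strictMono_vec_three htj hjt') ?_)
    intro x y hxy
    fin_cases x <;> fin_cases y <;> simp_all [patternQ3, Fin.rev]
  · rcases (hno b ⟨k, hk, hkb⟩ hb).eq_or_lt with rfl | hb'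
    · refine nQ patternQ3 (by simp [reflections])
        (contains_of_strictMono hr (strictMono_vec_three htj hjt') ?_)
      intro x y hxy
      fin_cases x <;> fin_cases y <;> simp_all [patternQ3]
    · refine nS (patternS2.submatrix Fin.rev Fin.rev) (by simp [reflections])
        (contains_of_strictMono hr (strictMono_vec_four htj hjt' hb') ?_)
      intro x y hxy
      fin_cases x <;> fin_cases y <;> simp_all [patternS2, Fin.rev]

theorem ne_reflect_rows {h w h' w' : ℕ} {M : ZeroOneMatrix h w} {P : ZeroOneMatrix h' w'}
    (hne : ∀ A ∈ P.reflections, (⟨h, w, M⟩ : SizedZeroOneMatrix) ≠ ⟨h', w', A⟩)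
    (A : ZeroOneMatrix h' w') (hA : A ∈ P.reflections) :
    (⟨h, w, M.submatrix Fin.rev id⟩ : SizedZeroOneMatrix) ≠ ⟨h', w', A⟩ := by
  intro heq
  cases heq
  refine hne _ (reflect_rows_mem_reflections hA) ?_
  rw [reflect_rows_twice]

theorem MinimallyNonlinear.exists_top_between {h w : ℕ} {M : ZeroOneMatrix h w}
    (hM : M.MinimallyNonlinear)
    (hQ : ∀ A ∈ patternQ3.reflections, (⟨h, w, M⟩ : SizedZeroOneMatrix) ≠ ⟨3, 3, A⟩)
    (hS : ∀ A ∈ patternS2.reflections, (⟨h, w, M⟩ : SizedZeroOneMatrix) ≠ ⟨3, 4, A⟩)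
    {b b' : Fin w} (hb : b ∈ M.bottomOnes) (hb' : b' ∈ M.bottomOnes) (hgap : (b : ℕ) + 2 ≤ b') :
    ∃ t ∈ M.topOnes, b < t ∧ t < b' := by
  rw [← topOnes_reflect_rows] at hb hb'
  have := hM.reflect_rows.exists_bottom_between (ne_reflect_rows hQ) (ne_reflect_rows hS) hb hb'
    hgap
  rwa [bottomOnes_reflect_rows] at this

/-! ### Classification of the top and bottom rows -/

/-- The sets `T` and `B` of columns are the sets of ones of the top and bottom rows of one of the
listed configurations or of a reflection of it. -/
def IsConfiguration {w : ℕ} (T B : Set (Fin w)) : Prop :=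
  ∃ C ∈ topBottomConfigurations, ∃ F ∈ C.2.reflections, ∃ c : Fin C.1 ↪o Fin w,
    T = c '' {j | F 0 j = 1} ∧ B = c '' {j | F 1 j = 1} ∧
    ∀ (i : Fin 2) (j k : Fin C.1), (k : ℕ) = (j : ℕ) + 1 → F i j = 1 → F i k = 1 →
      (c k : ℕ) = (c j : ℕ) + 1

theorem IsConfiguration.swap {w : ℕ} {T B : Set (Fin w)} (H : IsConfiguration T B) :
    IsConfiguration B T := by
  obtain ⟨C, hC, F, hF, c, hT, hB, hadj⟩ := H
  refine ⟨C, hC, F.submatrix Fin.rev id, reflect_rows_mem_reflections hF, c, hB, hT, ?_⟩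
  exact fun i => hadj i.rev

/-- The covering conditions compare columns as natural numbers so that `omega` settles them for
concrete `F`. -/
theorem isConfiguration_of {w v : ℕ} {T B : Set (Fin w)} (F₀ F : ZeroOneMatrix 2 v)
    (hF₀ : (⟨v, F₀⟩ : Σ v : ℕ, ZeroOneMatrix 2 v) ∈ topBottomConfigurations)
    (hF : F ∈ F₀.reflections) (c : Fin v → Fin w) (hc : StrictMono c)
    (hT₁ : ∀ k, F 0 k = 1 → c k ∈ T) (hT₂ : ∀ j ∈ T, ∃ k, F 0 k = 1 ∧ (c k : ℕ) = j)
    (hB₁ : ∀ k, F 1 k = 1 → c k ∈ B) (hB₂ : ∀ j ∈ B, ∃ k, F 1 k = 1 ∧ (c k : ℕ) = j)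
    (hadj : ∀ (i : Fin 2) (j k : Fin v), (k : ℕ) = (j : ℕ) + 1 → F i j = 1 → F i k = 1 →
      (c k : ℕ) = (c j : ℕ) + 1) : IsConfiguration T B := by
  refine ⟨⟨v, F₀⟩, hF₀, F, hF, OrderEmbedding.ofStrictMono c hc, ?_, ?_, hadj⟩
  · ext j
    constructor
    · intro hj
      obtain ⟨k, hk, hkj⟩ := hT₂ j hj
      exact ⟨k, hk, Fin.ext hkj⟩
    · rintro ⟨k, hk, rfl⟩
      exact hT₁ k hk
  · ext j
    constructor
    · intro hj
      obtain ⟨k, hk, hkj⟩ := hB₂ j hj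
      exact ⟨k, hk, Fin.ext hkj⟩
    · rintro ⟨k, hk, rfl⟩
      exact hB₁ k hk

/-! ### Recognising the individual configurations -/

section Classification

set_option linter.unnecessarySeqFocus false
set_option linter.unreachableTactic false
set_option linter.unusedTactic false
set_option linter.unusedSimpArgs false

theorem isConfiguration_single {w : ℕ} {T B : Set (Fin w)} {x : Fin w} (hT : x ∈ T) (hB : x ∈ B)
    (dT : ∀ j ∈ T, (j : ℕ) = x) (dB : ∀ j ∈ B, (j : ℕ) = x) :
    IsConfiguration T B := by
  refine isConfiguration_of !![1; 1] !![1; 1] (by simp [topBottomConfigurations]) ?_ ![x]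
    (Fin.strictMono_iff_lt_succ.2 fun i => ?_) (fun k => ?_) (fun j hj => ?_) (fun k => ?_)
    (fun j hj => ?_) (fun i j k => ?_)
  · exact List.mem_cons_self
  · exact i.elim0
  · fin_cases k <;> simp <;> assumption
  · have := dT j hj; simp [Fin.exists_fin_succ]; omega
  · fin_cases k <;> simp <;> assumption
  · have := dB j hj; simp [Fin.exists_fin_succ]; omega
  · fin_cases i <;> fin_cases j <;> fin_cases k <;> simp <;> omega

theorem isConfiguration_left {w : ℕ} {T B : Set (Fin w)} {x y : Fin w} (hT : x ∈ T) (hB : x ∈ B) (hy : y ∈ B)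
    (hxy : (y : ℕ) + 1 = x) (dT : ∀ j ∈ T, (j : ℕ) = x) (dB : ∀ j ∈ B, (j : ℕ) = y ∨ (j : ℕ) = x) :
    IsConfiguration T B := by
  refine isConfiguration_of !![0, 1; 1, 1] !![0, 1; 1, 1] (by simp [topBottomConfigurations]) ?_ ![y, x]
    (Fin.strictMono_iff_lt_succ.2 fun i => ?_) (fun k => ?_) (fun j hj => ?_) (fun k => ?_)
    (fun j hj => ?_) (fun i j k => ?_)
  · exact List.mem_cons_self
  · fin_cases i <;> simp only [Fin.lt_def] <;> simp <;> omega
  · fin_cases k <;> simp <;> assumption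
  · have := dT j hj; simp [Fin.exists_fin_succ]; omega
  · fin_cases k <;> simp <;> assumption
  · have := dB j hj; simp [Fin.exists_fin_succ]; omega
  · fin_cases i <;> fin_cases j <;> fin_cases k <;> simp <;> omega

theorem isConfiguration_right {w : ℕ} {T B : Set (Fin w)} {x y : Fin w} (hT : x ∈ T) (hB : x ∈ B) (hy : y ∈ B)
    (hxy : (x : ℕ) + 1 = y) (dT : ∀ j ∈ T, (j : ℕ) = x) (dB : ∀ j ∈ B, (j : ℕ) = x ∨ (j : ℕ) = y) :
    IsConfiguration T B := by
  refine isConfiguration_of !![0, 1; 1, 1] !![1, 0; 1, 1] (by simp [topBottomConfigurations]) ?_ ![x, y]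
    (Fin.strictMono_iff_lt_succ.2 fun i => ?_) (fun k => ?_) (fun j hj => ?_) (fun k => ?_)
    (fun j hj => ?_) (fun i j k => ?_)
  -- In `reflections`, index `1` is the left-right reflection, `2` the top-bottom one and `3` the
  -- half-turn.
  · refine List.mem_of_getElem (i := 1) (h := by simp [reflections]) ?_
    ext i j; fin_cases i <;> fin_cases j <;> rfl
  · fin_cases i <;> simp only [Fin.lt_def] <;> simp <;> omega
  · fin_cases k <;> simp <;> assumption
  · have := dT j hj; simp [Fin.exists_fin_succ]; omega
  · fin_cases k <;> simp <;> assumption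
  · have := dB j hj; simp [Fin.exists_fin_succ]; omega
  · fin_cases i <;> fin_cases j <;> fin_cases k <;> simp <;> omega

theorem isConfiguration_left_right {w : ℕ} {T B : Set (Fin w)} {x y z : Fin w} (hT : x ∈ T) (hB : x ∈ B)
    (hy : y ∈ B) (hz : z ∈ B) (hxy : (y : ℕ) + 1 = x) (hxz : (x : ℕ) + 1 = z)
    (dT : ∀ j ∈ T, (j : ℕ) = x) (dB : ∀ j ∈ B, (j : ℕ) = y ∨ (j : ℕ) = x ∨ (j : ℕ) = z) :
    IsConfiguration T B := by
  refine isConfiguration_of !![0, 1, 0; 1, 1, 1] !![0, 1, 0; 1, 1, 1] (by simp [topBottomConfigurations]) ?_ ![y, x, z]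
    (Fin.strictMono_iff_lt_succ.2 fun i => ?_) (fun k => ?_) (fun j hj => ?_) (fun k => ?_)
    (fun j hj => ?_) (fun i j k => ?_)
  · exact List.mem_cons_self
  · fin_cases i <;> simp only [Fin.lt_def] <;> simp <;> omega
  · fin_cases k <;> simp <;> assumption
  · have := dT j hj; simp [Fin.exists_fin_succ]; omega
  · fin_cases k <;> simp <;> assumption
  · have := dB j hj; simp [Fin.exists_fin_succ]; omega
  · fin_cases i <;> fin_cases j <;> fin_cases k <;> simp <;> omega

theorem isConfiguration_bottom_left_top_right {w : ℕ} {T B : Set (Fin w)} {x y z : Fin w} (hT : x ∈ T) (hB : x ∈ B)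
    (hy : y ∈ B) (hz : z ∈ T) (hxy : (y : ℕ) + 1 = x) (hxz : (x : ℕ) + 1 = z)
    (dT : ∀ j ∈ T, (j : ℕ) = x ∨ (j : ℕ) = z) (dB : ∀ j ∈ B, (j : ℕ) = y ∨ (j : ℕ) = x) :
    IsConfiguration T B := by
  refine isConfiguration_of !![0, 1, 1; 1, 1, 0] !![0, 1, 1; 1, 1, 0] (by simp [topBottomConfigurations]) ?_ ![y, x, z]
    (Fin.strictMono_iff_lt_succ.2 fun i => ?_) (fun k => ?_) (fun j hj => ?_) (fun k => ?_)
    (fun j hj => ?_) (fun i j k => ?_)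
  · exact List.mem_cons_self
  · fin_cases i <;> simp only [Fin.lt_def] <;> simp <;> omega
  · fin_cases k <;> simp <;> assumption
  · have := dT j hj; simp [Fin.exists_fin_succ]; omega
  · fin_cases k <;> simp <;> assumption
  · have := dB j hj; simp [Fin.exists_fin_succ]; omega
  · fin_cases i <;> fin_cases j <;> fin_cases k <;> simp <;> omega

theorem isConfiguration_two_blocks {w : ℕ} {T B : Set (Fin w)} {b b' t t' : Fin w} (hb : b ∈ B)
    (hb' : b' ∈ B) (ht : t ∈ T) (ht' : t' ∈ T) (hbt : (b' : ℕ) < t)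
    (eb : (b' : ℕ) = b ∨ (b' : ℕ) = b + 1) (et : (t' : ℕ) = t ∨ (t' : ℕ) = t + 1)
    (dT : ∀ j ∈ T, (t : ℕ) ≤ j ∧ (j : ℕ) ≤ t') (dB : ∀ j ∈ B, (b : ℕ) ≤ j ∧ (j : ℕ) ≤ b') :
    IsConfiguration T B := by
  rcases eb with eb | eb <;> rcases et with et | et
  · refine isConfiguration_of !![0, 1; 1, 0] !![0, 1; 1, 0] (by simp [topBottomConfigurations]) ?_ ![b, t]
      (Fin.strictMono_iff_lt_succ.2 fun i => ?_) (fun k => ?_) (fun j hj => ?_) (fun k => ?_)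
      (fun j hj => ?_) (fun i j k => ?_)
    · exact List.mem_cons_self
    · fin_cases i <;> simp only [Fin.lt_def] <;> simp <;> omega
    · fin_cases k <;> simp <;> assumption
    · have := dT j hj; simp [Fin.exists_fin_succ]; omega
    · fin_cases k <;> simp <;> assumption
    · have := dB j hj; simp [Fin.exists_fin_succ]; omega
    · fin_cases i <;> fin_cases j <;> fin_cases k <;> simp <;> omega
  · refine isConfiguration_of !![0, 0, 1; 1, 1, 0] !![0, 1, 1; 1, 0, 0] (by simp [topBottomConfigurations]) ?_ ![b, t, t']
      (Fin.strictMono_iff_lt_succ.2 fun i => ?_) (fun k => ?_) (fun j hj => ?_) (fun k => ?_)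
      (fun j hj => ?_) (fun i j k => ?_)
    · refine List.mem_of_getElem (i := 3) (h := by simp [reflections]) ?_
      ext i j; fin_cases i <;> fin_cases j <;> rfl
    · fin_cases i <;> simp only [Fin.lt_def] <;> simp <;> omega
    · fin_cases k <;> simp <;> assumption
    · have := dT j hj; simp [Fin.exists_fin_succ]; omega
    · fin_cases k <;> simp <;> assumption
    · have := dB j hj; simp [Fin.exists_fin_succ]; omega
    · fin_cases i <;> fin_cases j <;> fin_cases k <;> simp <;> omega
  · refine isConfiguration_of !![0, 0, 1; 1, 1, 0] !![0, 0, 1; 1, 1, 0] (by simp [topBottomConfigurations]) ?_ ![b, b', t]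
      (Fin.strictMono_iff_lt_succ.2 fun i => ?_) (fun k => ?_) (fun j hj => ?_) (fun k => ?_)
      (fun j hj => ?_) (fun i j k => ?_)
    · exact List.mem_cons_self
    · fin_cases i <;> simp only [Fin.lt_def] <;> simp <;> omega
    · fin_cases k <;> simp <;> assumption
    · have := dT j hj; simp [Fin.exists_fin_succ]; omega
    · fin_cases k <;> simp <;> assumption
    · have := dB j hj; simp [Fin.exists_fin_succ]; omega
    · fin_cases i <;> fin_cases j <;> fin_cases k <;> simp <;> omega
  · refine isConfiguration_of !![0, 0, 1, 1; 1, 1, 0, 0] !![0, 0, 1, 1; 1, 1, 0, 0] (by simp [topBottomConfigurations]) ?_ ![b, b', t, t']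
      (Fin.strictMono_iff_lt_succ.2 fun i => ?_) (fun k => ?_) (fun j hj => ?_) (fun k => ?_)
      (fun j hj => ?_) (fun i j k => ?_)
    · exact List.mem_cons_self
    · fin_cases i <;> simp only [Fin.lt_def] <;> simp <;> omega
    · fin_cases k <;> simp <;> assumption
    · have := dT j hj; simp [Fin.exists_fin_succ]; omega
    · fin_cases k <;> simp <;> assumption
    · have := dB j hj; simp [Fin.exists_fin_succ]; omega
    · fin_cases i <;> fin_cases j <;> fin_cases k <;> simp <;> omega

theorem isConfiguration_three_blocks {w : ℕ} {T B : Set (Fin w)} {b b' t t' d d' : Fin w}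
    (hb : b ∈ B) (hb' : b' ∈ B) (ht : t ∈ T) (ht' : t' ∈ T) (hd : d ∈ B) (hd' : d' ∈ B)
    (hbt : (b' : ℕ) < t) (htd : (t' : ℕ) < d) (eb : (b' : ℕ) = b ∨ (b' : ℕ) = b + 1)
    (et : (t' : ℕ) = t ∨ (t' : ℕ) = t + 1) (ed : (d' : ℕ) = d ∨ (d' : ℕ) = d + 1)
    (dT : ∀ j ∈ T, (t : ℕ) ≤ j ∧ (j : ℕ) ≤ t')
    (dB : ∀ j ∈ B, (b : ℕ) ≤ j ∧ (j : ℕ) ≤ b' ∨ (d : ℕ) ≤ j ∧ (j : ℕ) ≤ d') :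
    IsConfiguration T B := by
  rcases eb with eb | eb <;> rcases et with et | et <;> rcases ed with ed | ed
  · refine isConfiguration_of !![0, 1, 0; 1, 0, 1] !![0, 1, 0; 1, 0, 1] (by simp [topBottomConfigurations]) ?_ ![b, t, d]
      (Fin.strictMono_iff_lt_succ.2 fun i => ?_) (fun k => ?_) (fun j hj => ?_) (fun k => ?_)
      (fun j hj => ?_) (fun i j k => ?_)
    · exact List.mem_cons_self
    · fin_cases i <;> simp only [Fin.lt_def] <;> simp <;> omega
    · fin_cases k <;> simp <;> assumption
    · have := dT j hj; simp [Fin.exists_fin_succ]; omega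
    · fin_cases k <;> simp <;> assumption
    · have := dB j hj; simp [Fin.exists_fin_succ]; omega
    · fin_cases i <;> fin_cases j <;> fin_cases k <;> simp <;> omega
  · refine isConfiguration_of !![0, 0, 1, 0; 1, 1, 0, 1] !![0, 1, 0, 0; 1, 0, 1, 1] (by simp [topBottomConfigurations]) ?_ ![b, t, d, d']
      (Fin.strictMono_iff_lt_succ.2 fun i => ?_) (fun k => ?_) (fun j hj => ?_) (fun k => ?_)
      (fun j hj => ?_) (fun i j k => ?_)
    · refine List.mem_of_getElem (i := 1) (h := by simp [reflections]) ?_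
      ext i j; fin_cases i <;> fin_cases j <;> rfl
    · fin_cases i <;> simp only [Fin.lt_def] <;> simp <;> omega
    · fin_cases k <;> simp <;> assumption
    · have := dT j hj; simp [Fin.exists_fin_succ]; omega
    · fin_cases k <;> simp <;> assumption
    · have := dB j hj; simp [Fin.exists_fin_succ]; omega
    · fin_cases i <;> fin_cases j <;> fin_cases k <;> simp <;> omega
  · refine isConfiguration_of !![0, 1, 1, 0; 1, 0, 0, 1] !![0, 1, 1, 0; 1, 0, 0, 1] (by simp [topBottomConfigurations]) ?_ ![b, t, t', d]
      (Fin.strictMono_iff_lt_succ.2 fun i => ?_) (fun k => ?_) (fun j hj => ?_) (fun k => ?_)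
      (fun j hj => ?_) (fun i j k => ?_)
    · exact List.mem_cons_self
    · fin_cases i <;> simp only [Fin.lt_def] <;> simp <;> omega
    · fin_cases k <;> simp <;> assumption
    · have := dT j hj; simp [Fin.exists_fin_succ]; omega
    · fin_cases k <;> simp <;> assumption
    · have := dB j hj; simp [Fin.exists_fin_succ]; omega
    · fin_cases i <;> fin_cases j <;> fin_cases k <;> simp <;> omega
  · refine isConfiguration_of !![0, 0, 1, 1, 0; 1, 1, 0, 0, 1] !![0, 1, 1, 0, 0; 1, 0, 0, 1, 1] (by simp [topBottomConfigurations]) ?_ ![b, t, t', d, d']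
      (Fin.strictMono_iff_lt_succ.2 fun i => ?_) (fun k => ?_) (fun j hj => ?_) (fun k => ?_)
      (fun j hj => ?_) (fun i j k => ?_)
    · refine List.mem_of_getElem (i := 1) (h := by simp [reflections]) ?_
      ext i j; fin_cases i <;> fin_cases j <;> rfl
    · fin_cases i <;> simp only [Fin.lt_def] <;> simp <;> omega
    · fin_cases k <;> simp <;> assumption
    · have := dT j hj; simp [Fin.exists_fin_succ]; omega
    · fin_cases k <;> simp <;> assumption
    · have := dB j hj; simp [Fin.exists_fin_succ]; omega
    · fin_cases i <;> fin_cases j <;> fin_cases k <;> simp <;> omega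
  · refine isConfiguration_of !![0, 0, 1, 0; 1, 1, 0, 1] !![0, 0, 1, 0; 1, 1, 0, 1] (by simp [topBottomConfigurations]) ?_ ![b, b', t, d]
      (Fin.strictMono_iff_lt_succ.2 fun i => ?_) (fun k => ?_) (fun j hj => ?_) (fun k => ?_)
      (fun j hj => ?_) (fun i j k => ?_)
    · exact List.mem_cons_self
    · fin_cases i <;> simp only [Fin.lt_def] <;> simp <;> omega
    · fin_cases k <;> simp <;> assumption
    · have := dT j hj; simp [Fin.exists_fin_succ]; omega
    · fin_cases k <;> simp <;> assumption
    · have := dB j hj; simp [Fin.exists_fin_succ]; omega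
    · fin_cases i <;> fin_cases j <;> fin_cases k <;> simp <;> omega
  · refine isConfiguration_of !![0, 0, 1, 0, 0; 1, 1, 0, 1, 1] !![0, 0, 1, 0, 0; 1, 1, 0, 1, 1] (by simp [topBottomConfigurations]) ?_ ![b, b', t, d, d']
      (Fin.strictMono_iff_lt_succ.2 fun i => ?_) (fun k => ?_) (fun j hj => ?_) (fun k => ?_)
      (fun j hj => ?_) (fun i j k => ?_)
    · exact List.mem_cons_self
    · fin_cases i <;> simp only [Fin.lt_def] <;> simp <;> omega
    · fin_cases k <;> simp <;> assumption
    · have := dT j hj; simp [Fin.exists_fin_succ]; omega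
    · fin_cases k <;> simp <;> assumption
    · have := dB j hj; simp [Fin.exists_fin_succ]; omega
    · fin_cases i <;> fin_cases j <;> fin_cases k <;> simp <;> omega
  · refine isConfiguration_of !![0, 0, 1, 1, 0; 1, 1, 0, 0, 1] !![0, 0, 1, 1, 0; 1, 1, 0, 0, 1] (by simp [topBottomConfigurations]) ?_ ![b, b', t, t', d]
      (Fin.strictMono_iff_lt_succ.2 fun i => ?_) (fun k => ?_) (fun j hj => ?_) (fun k => ?_)
      (fun j hj => ?_) (fun i j k => ?_)
    · exact List.mem_cons_self
    · fin_cases i <;> simp only [Fin.lt_def] <;> simp <;> omega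
    · fin_cases k <;> simp <;> assumption
    · have := dT j hj; simp [Fin.exists_fin_succ]; omega
    · fin_cases k <;> simp <;> assumption
    · have := dB j hj; simp [Fin.exists_fin_succ]; omega
    · fin_cases i <;> fin_cases j <;> fin_cases k <;> simp <;> omega
  · refine isConfiguration_of !![0, 0, 1, 1, 0, 0; 1, 1, 0, 0, 1, 1] !![0, 0, 1, 1, 0, 0; 1, 1, 0, 0, 1, 1] (by simp [topBottomConfigurations]) ?_ ![b, b', t, t', d, d']
      (Fin.strictMono_iff_lt_succ.2 fun i => ?_) (fun k => ?_) (fun j hj => ?_) (fun k => ?_)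
      (fun j hj => ?_) (fun i j k => ?_)
    · exact List.mem_cons_self
    · fin_cases i <;> simp only [Fin.lt_def] <;> simp <;> omega
    · fin_cases k <;> simp <;> assumption
    · have := dT j hj; simp [Fin.exists_fin_succ]; omega
    · fin_cases k <;> simp <;> assumption
    · have := dB j hj; simp [Fin.exists_fin_succ]; omega
    · fin_cases i <;> fin_cases j <;> fin_cases k <;> simp <;> omega

end Classification

/-! ### Combinatorial classification of the two column sets -/

theorem isConfiguration_of_shared {w : ℕ} {T B : Set (Fin w)} {x : Fin w}
    (gT : ∀ t ∈ T, ∀ t' ∈ T, (t : ℕ) + 2 ≤ t' → ∃ b ∈ B, t < b ∧ b < t')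
    (gB : ∀ b ∈ B, ∀ b' ∈ B, (b : ℕ) + 2 ≤ b' → ∃ t ∈ T, b < t ∧ t < b')
    (hxT : x ∈ T) (hxB : x ∈ B) (hright : ∀ t ∈ T, ∀ b ∈ B, x < t → x < b → False)
    (hleft : ∀ t ∈ T, ∀ b ∈ B, t < x → b < x → False) : IsConfiguration T B := by
  -- On each side of `x` only one of the two sets continues, and the gap property then confines it
  -- to the column next to `x`. The claim is stated for arbitrary `T` and `B` so that it also
  -- applies with the roles exchanged.
  have right : ∀ {T B : Set (Fin w)}, (∀ b ∈ B, ∀ b' ∈ B, (b : ℕ) + 2 ≤ b' →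
      ∃ t ∈ T, b < t ∧ t < b') → x ∈ B → (∀ t ∈ T, ∀ b ∈ B, x < t → x < b → False) →
      ∀ b ∈ B, x < b → (b : ℕ) = x + 1 ∧ ∀ t ∈ T, t ≤ x := by
    intro T B gB hxB hright b hb hxb
    refine ⟨?_, fun t ht => not_lt.1 fun h => hright t ht b hb h hxb⟩
    by_contra hne
    rw [Fin.lt_def] at hxb
    obtain ⟨t, ht, hxt, -⟩ := gB x hxB b hb (by omega)
    exact hright t ht b hb hxt hxb
  have left : ∀ {T B : Set (Fin w)}, (∀ b ∈ B, ∀ b' ∈ B, (b : ℕ) + 2 ≤ b' →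
      ∃ t ∈ T, b < t ∧ t < b') → x ∈ B → (∀ t ∈ T, ∀ b ∈ B, t < x → b < x → False) →
      ∀ b ∈ B, b < x → (b : ℕ) + 1 = x ∧ ∀ t ∈ T, x ≤ t := by
    intro T B gB hxB hleft b hb hxb
    refine ⟨?_, fun t ht => not_lt.1 fun h => hleft t ht b hb h hxb⟩
    by_contra hne
    rw [Fin.lt_def] at hxb
    obtain ⟨t, ht, -, hxt⟩ := gB b hb x hxB (by omega)
    exact hleft t ht b hb hxt hxb
  have rB := right gB hxB hright
  have rT := right gT hxT fun b hb t ht h h' => hright t ht b hb h' h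
  have lB := left gB hxB hleft
  have lT := left gT hxT fun b hb t ht h h' => hleft t ht b hb h' h
  simp only [Fin.lt_def, Fin.le_def] at rB rT lB lT
  by_cases h1 : ∃ b ∈ B, (b : ℕ) < x
  · obtain ⟨y, hy, hyx⟩ := h1
    have ly := lB y hy hyx
    by_cases h2 : ∃ b ∈ B, (x : ℕ) < b
    · obtain ⟨z, hz, hxz⟩ := h2
      have rz := rB z hz hxz
      refine isConfiguration_left_right hxT hxB hy hz ly.1 rz.1.symm (fun j hj => ?_)
        fun j hj => ?_
      · exact le_antisymm (rz.2 j hj) (ly.2 j hj)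
      · have := rB j hj
        have := lB j hj
        omega
    · push Not at h2
      by_cases h3 : ∃ t ∈ T, (x : ℕ) < t
      · obtain ⟨z, hz, hxz⟩ := h3
        have rz := rT z hz hxz
        refine isConfiguration_bottom_left_top_right hxT hxB hy hz ly.1 rz.1.symm
          (fun j hj => ?_) fun j hj => ?_
        · have := rT j hj
          have := ly.2 j hj
          omega
        · have := lB j hj
          have := h2 j hj
          omega
      · push Not at h3
        refine isConfiguration_left hxT hxB hy ly.1 (fun j hj => ?_) fun j hj => ?_
        · exact le_antisymm (h3 j hj) (ly.2 j hj)
        · have := lB j hj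
          have := h2 j hj
          omega
  · push Not at h1
    by_cases h2 : ∃ t ∈ T, (t : ℕ) < x
    · obtain ⟨y, hy, hyx⟩ := h2
      have ly := lT y hy hyx
      by_cases h3 : ∃ b ∈ B, (x : ℕ) < b
      · obtain ⟨z, hz, hxz⟩ := h3
        have rz := rB z hz hxz
        refine (isConfiguration_bottom_left_top_right hxB hxT hy hz ly.1 rz.1.symm
          (fun j hj => ?_) fun j hj => ?_).swap
        · have := rB j hj
          have := ly.2 j hj
          omega
        · have := lT j hj
          have := rz.2 j hj
          omega
      · push Not at h3
        by_cases h4 : ∃ t ∈ T, (x : ℕ) < t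
        · obtain ⟨z, hz, hxz⟩ := h4
          have rz := rT z hz hxz
          refine (isConfiguration_left_right hxB hxT hy hz ly.1 rz.1.symm (fun j hj => ?_)
            fun j hj => ?_).swap
          · exact le_antisymm (rz.2 j hj) (ly.2 j hj)
          · have := rT j hj
            have := lT j hj
            omega
        · push Not at h4
          refine (isConfiguration_left hxB hxT hy ly.1 (fun j hj => ?_) fun j hj => ?_).swap
          · exact le_antisymm (h3 j hj) (ly.2 j hj)
          · have := lT j hj
            have := h4 j hj
            omega
    · push Not at h2
      by_cases h3 : ∃ b ∈ B, (x : ℕ) < b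
      · obtain ⟨z, hz, hxz⟩ := h3
        have rz := rB z hz hxz
        refine isConfiguration_right hxT hxB hz rz.1.symm (fun j hj => ?_) fun j hj => ?_
        · exact le_antisymm (rz.2 j hj) (h2 j hj)
        · have := rB j hj
          have := h1 j hj
          omega
      · push Not at h3
        by_cases h4 : ∃ t ∈ T, (x : ℕ) < t
        · obtain ⟨z, hz, hxz⟩ := h4
          have rz := rT z hz hxz
          refine (isConfiguration_right hxB hxT hz rz.1.symm (fun j hj => ?_) fun j hj => ?_).swap
          · exact le_antisymm (rz.2 j hj) (h1 j hj)
          · have := rT j hj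
            have := h2 j hj
            omega
        · push Not at h4
          exact isConfiguration_single hxT hxB
            (fun j hj => le_antisymm (h4 j hj) (h2 j hj))
            (fun j hj => le_antisymm (h3 j hj) (h1 j hj))

theorem exists_greatest {w : ℕ} {S : Set (Fin w)} (hS : S.Nonempty) :
    ∃ m ∈ S, ∀ j ∈ S, (j : ℕ) ≤ m :=
  Set.exists_max_image S (fun j => (j : ℕ)) S.toFinite hS

theorem exists_least {w : ℕ} {S : Set (Fin w)} (hS : S.Nonempty) :
    ∃ m ∈ S, ∀ j ∈ S, (m : ℕ) ≤ j :=
  Set.exists_min_image S (fun j => (j : ℕ)) S.toFinite hS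

/-- Without a four-term alternation, the columns form two blocks `B T` or three blocks `B T B`.
Inside a block no column of the other set occurs, so by the gap property each block is one column or
two adjacent ones. -/
theorem isConfiguration_of_disjoint {w : ℕ} {T B : Set (Fin w)}
    (gT : ∀ t ∈ T, ∀ t' ∈ T, (t : ℕ) + 2 ≤ t' → ∃ b ∈ B, t < b ∧ b < t')
    (gB : ∀ b ∈ B, ∀ b' ∈ B, (b : ℕ) + 2 ≤ b' → ∃ t ∈ T, b < t ∧ t < b')
    (hdisj : ∀ j ∈ T, j ∉ B)
    (hT : ∀ t ∈ T, ∀ b ∈ B, ∀ t' ∈ T, ∀ b' ∈ B, t < b → b < t' → t' < b' → False)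
    (hB : ∀ b ∈ B, ∀ t ∈ T, ∀ b' ∈ B, ∀ t' ∈ T, b < t → t < b' → b' < t' → False)
    {b t : Fin w} (hb : b ∈ B) (hbmin : ∀ j ∈ B, (b : ℕ) ≤ j) (ht : t ∈ T)
    (htmin : ∀ j ∈ T, (t : ℕ) ≤ j) (hbt : (b : ℕ) < t) : IsConfiguration T B := by
  obtain ⟨t', ht', htmax⟩ := exists_greatest ⟨t, ht⟩
  have hne : ∀ j ∈ T, ∀ k ∈ B, (j : ℕ) ≠ k := fun j hj k hk h =>
    hdisj j hj (by rwa [Fin.ext h])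
  simp only [Fin.lt_def] at gT gB hT hB
  obtain ⟨b', ⟨hb', hbt'⟩, hb'max⟩ := exists_greatest (S := {j | j ∈ B ∧ (j : ℕ) < t}) ⟨b, hb, hbt⟩
  have eb : (b' : ℕ) = b ∨ (b' : ℕ) = b + 1 := by
    have := hbmin b' hb'
    by_contra hcon
    obtain ⟨j, hj, h1, h2⟩ := gB b hb b' hb' (by omega)
    have := htmin j hj
    omega
  have htt' := htmin t' ht'
  by_cases hd : ∃ j ∈ B, (t' : ℕ) < j
  · obtain ⟨d', ⟨hd', htd'⟩, hd'max⟩ :=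
      exists_greatest (S := {j | j ∈ B ∧ (t' : ℕ) < j}) hd
    obtain ⟨d, ⟨hdB, htd⟩, hdmin⟩ := exists_least (S := {j | j ∈ B ∧ (t' : ℕ) < j}) hd
    have et : (t' : ℕ) = t ∨ (t' : ℕ) = t + 1 := by
      by_contra hcon
      obtain ⟨j, hj, h1, h2⟩ := gT t ht t' ht' (by omega)
      -- A bottom one inside the top block, followed by the later `d'`, would alternate.
      exact hT t ht j hj t' ht' d' hd' h1 h2 htd'
    have ed : (d' : ℕ) = d ∨ (d' : ℕ) = d + 1 := by
      have := hdmin d' ⟨hd', htd'⟩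
      by_contra hcon
      obtain ⟨j, hj, h1, h2⟩ := gB d hdB d' hd' (by omega)
      have := htmax j hj
      omega
    refine isConfiguration_three_blocks hb hb' ht ht' hdB hd' hbt' htd eb et ed
      (fun j hj => ⟨htmin j hj, htmax j hj⟩) fun j hj => ?_
    have n1 := hne t ht j hj
    have n2 := hne t' ht' j hj
    rcases lt_or_ge (j : ℕ) t with h1 | h1
    · exact Or.inl ⟨hbmin j hj, hb'max j ⟨hj, h1⟩⟩
    · rcases lt_or_ge (t' : ℕ) j with h2 | h2
      · exact Or.inr ⟨hdmin j ⟨hj, h2⟩, hd'max j ⟨hj, h2⟩⟩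
      · omega
  · push Not at hd
    have hlast : ∀ j ∈ B, (j : ℕ) < t := by
      intro j hj
      by_contra! hcon
      have n1 := hne t ht j hj
      have n2 := hne t' ht' j hj
      have := hd j hj
      exact hB b hb t ht j hj t' ht' hbt (by omega) (by omega)
    refine isConfiguration_two_blocks hb hb' ht ht' hbt' eb ?_
      (fun j hj => ⟨htmin j hj, htmax j hj⟩) fun j hj => ⟨hbmin j hj, hb'max j ⟨hj, hlast j hj⟩⟩
    by_contra hcon
    obtain ⟨j, hj, h1, h2⟩ := gT t ht t' ht' (by omega)
    have := hlast j hj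
    omega

theorem isConfiguration_of_sets {w : ℕ} {T B : Set (Fin w)} (hTne : T.Nonempty)
    (hBne : B.Nonempty)
    (gT : ∀ t ∈ T, ∀ t' ∈ T, (t : ℕ) + 2 ≤ t' → ∃ b ∈ B, t < b ∧ b < t')
    (gB : ∀ b ∈ B, ∀ b' ∈ B, (b : ℕ) + 2 ≤ b' → ∃ t ∈ T, b < t ∧ t < b')
    (hright : ∀ x ∈ T, x ∈ B → ∀ t ∈ T, ∀ b ∈ B, x < t → x < b → False)
    (hleft : ∀ x ∈ T, x ∈ B → ∀ t ∈ T, ∀ b ∈ B, t < x → b < x → False)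
    (hT : ∀ t ∈ T, ∀ b ∈ B, ∀ t' ∈ T, ∀ b' ∈ B, t < b → b < t' → t' < b' → False)
    (hB : ∀ b ∈ B, ∀ t ∈ T, ∀ b' ∈ B, ∀ t' ∈ T, b < t → t < b' → b' < t' → False) :
    IsConfiguration T B := by
  by_cases hx : ∃ x ∈ T, x ∈ B
  · obtain ⟨x, hxT, hxB⟩ := hx
    exact isConfiguration_of_shared gT gB hxT hxB (hright x hxT hxB) (hleft x hxT hxB)
  · push Not at hx
    obtain ⟨t, ht, htmin⟩ := exists_least hTne
    obtain ⟨b, hb, hbmin⟩ := exists_least hBne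
    rcases lt_trichotomy (b : ℕ) t with h | h | h
    · exact isConfiguration_of_disjoint gT gB hx hT hB hb hbmin ht htmin h
    · exact absurd hb (by rw [Fin.ext h]; exact hx t ht)
    · exact (isConfiguration_of_disjoint gB gT (fun j hj hj' => hx j hj' hj) hB hT ht htmin hb
        hbmin h).swap

/-! ### From forbidden patterns to the theorem -/

theorem hasTopBottom_self {v : ℕ} (F : ZeroOneMatrix 2 v) : F.HasTopBottom F := by
  refine ⟨RelEmbedding.refl _, ?_, ?_, fun _ _ _ h _ _ => h⟩
  · ext j
    simp only [RelEmbedding.refl_apply, Set.image_id']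
    constructor
    · rintro ⟨i, hi, hij⟩
      obtain rfl : i = 0 := Fin.ext hi
      exact hij
    · exact fun h => ⟨0, rfl, h⟩
  · ext j
    simp only [RelEmbedding.refl_apply, Set.image_id']
    constructor
    · rintro ⟨i, hi, hij⟩
      obtain rfl : i = 1 := Fin.ext (Nat.succ_injective hi)
      exact hij
    · exact fun h => ⟨1, rfl, h⟩

theorem MinimallyNonlinear.hasTopBottom_of_contains {h w v : ℕ} {M : ZeroOneMatrix h w}
    (hM : M.MinimallyNonlinear) {F₀ F : ZeroOneMatrix 2 v}
    (hF₀ : (⟨v, F₀⟩ : Σ v : ℕ, ZeroOneMatrix 2 v) ∈ topBottomConfigurations)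
    (hsup : F₀.Superlinear) (hF : F ∈ F₀.reflections) (hc : M.Contains F) :
    ∃ C ∈ topBottomConfigurations, ∃ F ∈ C.2.reflections, M.HasTopBottom F := by
  cases hM.eq_of_contains (hsup.of_mem_reflections hF) hc
  exact ⟨_, hF₀, _, hF, hasTopBottom_self _⟩

theorem contains_two_rows {h w v : ℕ} {M : ZeroOneMatrix h w} {F : ZeroOneMatrix 2 v}
    {i k : Fin h} (hik : i < k) {c : Fin v → Fin w} (hc : StrictMono c)
    (h₀ : ∀ j, F 0 j = 1 → M i (c j) = 1) (h₁ : ∀ j, F 1 j = 1 → M k (c j) = 1) :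
    M.Contains F := by
  refine contains_of_strictMono (strictMono_vec_two hik) hc fun a j haj => ?_
  fin_cases a
  · exact h₀ j haj
  · exact h₁ j haj

theorem superlinear_config_two : Superlinear !![1, 0, 1; 1, 1, 0] := by
  refine superlinear_shared.of_mem_reflections (List.mem_of_getElem (i := 3)
    (h := by simp [reflections]) ?_)
  ext i j; fin_cases i <;> fin_cases j <;> rfl

theorem superlinear_config_three : Superlinear !![1, 0, 1, 0; 0, 1, 0, 1] := by
  refine superlinear_alternation.of_mem_reflections (List.mem_of_getElem (i := 1)
    (h := by simp [reflections]) ?_)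
  ext i j; fin_cases i <;> fin_cases j <;> rfl

end ZeroOneMatrix

open ZeroOneMatrix in
theorem mainTheorem7 (h w : ℕ) (M : ZeroOneMatrix h w) (hM : M.MinimallyNonlinear)
    (hQ : ∀ A ∈ ZeroOneMatrix.patternQ3.reflections,
      (⟨h, w, M⟩ : SizedZeroOneMatrix) ≠ ⟨3, 3, A⟩)
    (hS : ∀ A ∈ ZeroOneMatrix.patternS2.reflections,
      (⟨h, w, M⟩ : SizedZeroOneMatrix) ≠ ⟨3, 4, A⟩) :
    ∃ C ∈ ZeroOneMatrix.topBottomConfigurations,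
      ∃ F ∈ C.2.reflections, M.HasTopBottom F := by
  by_contra hcon
  -- Containing a reflection of one of the first three configurations already finishes the proof, so
  -- from here on `M` avoids all of them.
  have n1 := fun F hF hc => hcon (hM.hasTopBottom_of_contains (F := F)
    (by simp [topBottomConfigurations]) superlinear_square hF hc)
  have n2 := fun F hF hc => hcon (hM.hasTopBottom_of_contains (F := F)
    (by simp [topBottomConfigurations]) superlinear_config_two hF hc)
  have n3 := fun F hF hc => hcon (hM.hasTopBottom_of_contains (F := F)
    (by simp [topBottomConfigurations]) superlinear_config_three hF hc)
  have hh := hM.two_le_height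
  let i : Fin h := ⟨0, by omega⟩
  let k : Fin h := ⟨h - 1, by omega⟩
  have hr : i < k := by rw [Fin.lt_def]; simp only [i, k]; omega
  have hi : ∀ j ∈ M.topOnes, M i j = 1 := by
    rintro j ⟨l, hl, hlj⟩
    rwa [show i = l from Fin.ext hl.symm]
  have hk : ∀ j ∈ M.bottomOnes, M k j = 1 := by
    rintro j ⟨l, hl, hlj⟩
    rwa [show k = l from Fin.ext (by simp only [k]; omega)]
  refine hcon (isConfiguration_of_sets hM.exists_top_one hM.exists_bottom_one
    (fun t ht t' ht' => hM.exists_bottom_between hQ hS ht ht')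
    (fun b hb b' hb' => hM.exists_top_between hQ hS hb hb') ?_ ?_ ?_ ?_)
  -- A top and a bottom one on the same side of a shared column form the square if their columns
  -- coincide, and otherwise a reflection of the second configuration.
  · intro x hxT hxB t ht b hb hxt hxb
    have h1 := hi x hxT; have h2 := hk x hxB; have h3 := hi t ht; have h4 := hk b hb
    rcases lt_trichotomy b t with hbt | rfl | hbt
    · refine n2 !![1, 0, 1; 1, 1, 0] (List.mem_of_getElem (i := 0)
        (h := by simp [reflections]) (by ext i j; fin_cases i <;> fin_cases j <;> rfl))
        (contains_two_rows (c := ![x, b, t]) hr (strictMono_vec_three hxb hbt) (fun j hj => ?_) fun j hj => ?_)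
      · fin_cases j <;> first | exact h1 | exact h2 | exact h3 | exact h4 | simp at hj
      · fin_cases j <;> first | exact h1 | exact h2 | exact h3 | exact h4 | simp at hj
    · refine n1 !![1, 1; 1, 1] (List.mem_of_getElem (i := 0)
        (h := by simp [reflections]) (by ext i j; fin_cases i <;> fin_cases j <;> rfl))
        (contains_two_rows (c := ![x, b]) hr (strictMono_vec_two hxb) (fun j hj => ?_) fun j hj => ?_)
      · fin_cases j; exacts [h1, h3]
      · fin_cases j; exacts [h2, h4]
    · refine n2 !![1, 1, 0; 1, 0, 1] (List.mem_of_getElem (i := 2)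
        (h := by simp [reflections]) (by ext i j; fin_cases i <;> fin_cases j <;> rfl))
        (contains_two_rows (c := ![x, t, b]) hr (strictMono_vec_three hxt hbt) (fun j hj => ?_) fun j hj => ?_)
      · fin_cases j <;> first | exact h1 | exact h2 | exact h3 | exact h4 | simp at hj
      · fin_cases j <;> first | exact h1 | exact h2 | exact h3 | exact h4 | simp at hj
  · intro x hxT hxB t ht b hb hxt hxb
    have h1 := hi x hxT; have h2 := hk x hxB; have h3 := hi t ht; have h4 := hk b hb
    rcases lt_trichotomy b t with hbt | rfl | hbt
    · refine n2 !![0, 1, 1; 1, 0, 1] (List.mem_of_getElem (i := 3)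
        (h := by simp [reflections]) (by ext i j; fin_cases i <;> fin_cases j <;> rfl))
        (contains_two_rows (c := ![b, t, x]) hr (strictMono_vec_three hbt hxt) (fun j hj => ?_) fun j hj => ?_)
      · fin_cases j <;> first | exact h1 | exact h2 | exact h3 | exact h4 | simp at hj
      · fin_cases j <;> first | exact h1 | exact h2 | exact h3 | exact h4 | simp at hj
    · refine n1 !![1, 1; 1, 1] (List.mem_of_getElem (i := 0)
        (h := by simp [reflections]) (by ext i j; fin_cases i <;> fin_cases j <;> rfl))
        (contains_two_rows (c := ![b, x]) hr (strictMono_vec_two hxb) (fun j hj => ?_) fun j hj => ?_)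
      · fin_cases j; exacts [h3, h1]
      · fin_cases j; exacts [h4, h2]
    · refine n2 !![1, 0, 1; 0, 1, 1] (List.mem_of_getElem (i := 1)
        (h := by simp [reflections]) (by ext i j; fin_cases i <;> fin_cases j <;> rfl))
        (contains_two_rows (c := ![t, b, x]) hr (strictMono_vec_three hbt hxb) (fun j hj => ?_) fun j hj => ?_)
      · fin_cases j <;> first | exact h1 | exact h2 | exact h3 | exact h4 | simp at hj
      · fin_cases j <;> first | exact h1 | exact h2 | exact h3 | exact h4 | simp at hj
  · intro t ht b hb t' ht' b' hb' l1 l2 l3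
    have h1 := hi t ht; have h2 := hk b hb; have h3 := hi t' ht'; have h4 := hk b' hb'
    refine n3 !![1, 0, 1, 0; 0, 1, 0, 1] (List.mem_of_getElem (i := 0)
      (h := by simp [reflections]) (by ext i j; fin_cases i <;> fin_cases j <;> rfl))
      (contains_two_rows (c := ![t, b, t', b']) hr (strictMono_vec_four l1 l2 l3) (fun j hj => ?_) fun j hj => ?_)
    · fin_cases j <;> first | exact h1 | exact h2 | exact h3 | exact h4 | simp at hj
    · fin_cases j <;> first | exact h1 | exact h2 | exact h3 | exact h4 | simp at hj
  · intro b hb t ht b' hb' t' ht' l1 l2 l3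
    have h1 := hk b hb; have h2 := hi t ht; have h3 := hk b' hb'; have h4 := hi t' ht'
    refine n3 !![0, 1, 0, 1; 1, 0, 1, 0] (List.mem_of_getElem (i := 1)
      (h := by simp [reflections]) (by ext i j; fin_cases i <;> fin_cases j <;> rfl))
      (contains_two_rows (c := ![b, t, b', t']) hr (strictMono_vec_four l1 l2 l3) (fun j hj => ?_) fun j hj => ?_)
    · fin_cases j <;> first | exact h1 | exact h2 | exact h3 | exact h4 | simp at hj
    · fin_cases j <;> first | exact h1 | exact h2 | exact h3 | exact h4 | simp at hj
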